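/- **Setting.** Let $\mathbb K$ be a field, $R=\mathbb K[x_1,\dots,x_n]$ with a fixed monomial order; $\operatorname{lm}$ and $\operatorname{lt}$ denote leading monomial and leading term ($0$ has no leading monomial). A Gröbner basis of an ideal $I$ is a finite set $B\subseteq I$ whose leading terms generate the ideal of leading terms of $I$ (it may contain $0$). *Data.* An sGB tree $\mathcal T$ consists of: a finite rooted tree $T$ with nodes labelled by integers, each node $\nu$ holding a polynomial $\operatorname{poly}(\nu)\in R$; a list $G$, in order of addition, of triples $\alpha=(\operatorname{poly}(\alpha),\mathfrak s(\alpha),\operatorname{quo}(\alpha))$ (sig-poly pairs) with $\operatorname{poly}(\alpha),\operatorname{quo}(\alpha)\in R$ and a signature $\mathfrak s(\alpha)=(\operatorname{ind}(\alpha),m)$, where $\operatorname{ind}(\alpha)$ is a node and $m$ a monomial; a set $P$ of pairs of entries of $G$; and a set $S_\nu\subseteq R$ for each node $\nu$. Write $\mu\le_T\nu$ if $\mu$ lies on the path from the root to $\nu$. Put $(\mu,m)<(\nu,m')$ iff $\mu<_T\nu$, or $\mu=\nu$ and $m<m'$. A monomial (or term) $a$ acts on $\alpha$ by multiplying $\operatorname{poly}$,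 $\operatorname{quo}$ and the monomial of the signature, with $\mathfrak s(a\alpha)$ ignoring the coefficient of $a$; $(\mu,m)$ divides $(\nu,m')$ if $\mu=\nu$ and $m\mid m'$. *S-pairs.* For $\alpha,\beta$ with nonzero polynomial parts let $c=\operatorname{lcm}(\operatorname{lm}\operatorname{poly}(\alpha),\operatorname{lm}\operatorname{poly}(\beta))$, $a=c/\operatorname{lt}\operatorname{poly}(\alpha)$, $b=c/\operatorname{lt}\operatorname{poly}(\beta)$. They form a regular S-pair if their indices are comparable and $\mathfrak s(a\alpha)\ne\mathfrak s(b\beta)$. Ordering them so that $\mathfrak s(\alpha)>\mathfrak s(\beta)$ (in either order if $\mathfrak s(\alpha)=\mathfrak s(\beta)$), their S-pair is the triple with polynomial part $a\operatorname{poly}(\alpha)-b\operatorname{poly}(\beta)$, signature $\max(\mathfrak s(a\alpha),\mathfrak s(b\beta))$ and quotient $a\operatorname{quo}(\alpha)-b\operatorname{quo}(\beta)$ if the indices are equal, $a\operatorname{quo}(\alpha)$ otherwise. *Regular reduction* of $\gamma$ modulo $G$: while there is $\beta\in G$ with nonzero polynomial part such that $\operatorname{poly}(\gamma)\neq0$,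 $\operatorname{lm}\operatorname{poly}(\beta)\mid\operatorname{lm}\operatorname{poly}(\gamma)$ and $\mathfrak s(b\beta)<\mathfrak s(\gamma)$, where $b=\operatorname{lt}\operatorname{poly}(\gamma)/\operatorname{lt}\operatorname{poly}(\beta)$, choose any such $\beta$, subtract $b\operatorname{poly}(\beta)$ from $\operatorname{poly}(\gamma)$ and, if $\operatorname{ind}(\beta)=\operatorname{ind}(\gamma)$, subtract $b\operatorname{quo}(\beta)$ from $\operatorname{quo}(\gamma)$; the signature is kept. *Rewritability.* For $\alpha\in G$ and a monomial $a$, $a\alpha$ is rewritable if there is $\delta\in G$ such that either $\mathfrak s(\delta)$ divides $\mathfrak s(a\alpha)$ and $\delta$ was added to $G$ later than $\alpha$; or $\mathfrak s(\delta)$ divides $\mathfrak s(a\alpha)$ and $\operatorname{poly}(\delta)=0$; or $\operatorname{ind}(\delta)<_T\operatorname{ind}(\alpha)$, $\operatorname{poly}(\delta)\ne0$ and $\operatorname{lm}\operatorname{poly}(\delta)\mid\operatorname{lm}\operatorname{quo}(\alpha)$. *Procedures.* - $\mathrm{ProcessSPair}(\mathcal T,\nu)$: among the pairs $(\alpha,\beta)\in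 P$ with $\max(\operatorname{ind}(\alpha),\operatorname{ind}(\beta))\le_T\nu$ (if there are any) choose one whose S-pair has minimal signature and remove it from $P$. If neither $a\alpha$ nor $b\beta$ is rewritable, apply regular reduction modulo $G$ to the S-pair, obtaining $\gamma$, and append $\gamma$ to $G$; if $\operatorname{poly}(\gamma)\neq0$, add to $P$ all pairs $(\gamma,\beta)$, $\beta\in G$, forming a regular S-pair; otherwise add $\operatorname{quo}(\gamma)$ to $S_{\operatorname{ind}(\gamma)}$. - $\mathrm{Basis}(\mathcal T,\nu)$: while $P$ contains a pair with both indices $\le_T\nu$, call $\mathrm{ProcessSPair}(\mathcal T,\nu)$; then return $\{\operatorname{poly}(\alpha): \alpha\in G,\ \operatorname{ind}(\alpha)\le_T\nu\}$. - $\mathrm{GetSyzygy}(\mathcal T,\nu)$: while $P$ contains a pair with both indices $\le_T\nu$ and $S_\nu=\varnothing$, call $\mathrm{ProcessSPair}(\mathcal T,\nu)$; then, if $S_\nu\ne\varnothing$, remove some element from $S_\nu$ and return it, and otherwise return $0$. - $\mathrm{InsertNode}(\mathcal T,f,\text{position})$: insert in $T$ a new node $\nu$, labelled by the largest label plus one and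 holding $f$ (as the root if $T$ is empty, as a new leaf below a given node, or just above a given node, that is on the edge to its parent or as a new root); set $S_\nu=\varnothing$ and $\epsilon=(f,(\nu,1),1)$; add to $P$ all pairs $(\epsilon,\beta)$, $\beta\in G$, forming a regular S-pair; append $\epsilon$ to $G$. **Proposition.** Let $\mathcal T$ be an sGB tree that results from the empty tree by any finite sequence of completed calls to $\mathrm{InsertNode}$, $\mathrm{Basis}$ and $\mathrm{GetSyzygy}$ (with arbitrary polynomials, positions and nodes), and let $\nu$ be a node of $\mathcal T$. Then, whatever choices are made, $\mathrm{Basis}(\mathcal T,\nu)$ terminates (including the regular reductions inside it), and it returns a Gröbner basis of the ideal $I_\nu$ generated by the polynomials at the nodes on the path from the root to $\nu$, both included. -/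

import Mathlib

open scoped MonomialOrder

namespace SigGB

/-- A finite set `B ⊆ I` is a Gröbner basis of `I` if the leading terms of `B` generate the ideal
of leading terms of `I`.  (The leading term of `0` is `0`, so that `B` may contain `0`.) -/
def IsGroebnerBasis {n : ℕ} {K : Type*} [Field K] (m : MonomialOrder (Fin n))
    (B : Set (MvPolynomial (Fin n) K)) (I : Ideal (MvPolynomial (Fin n) K)) : Prop :=
  B.Finite ∧ B ⊆ (I : Set (MvPolynomial (Fin n) K)) ∧
    Ideal.span (m.leadingTerm '' B) =
      Ideal.span (m.leadingTerm '' (I : Set (MvPolynomial (Fin n) K)))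

/-- A signature: an index (the label of a node of the tree) and a monomial (its exponent). -/
@[ext] structure Signature (n : ℕ) where
  ind : ℕ
  mon : Fin n →₀ ℕ

/-- The product `a σ` of the monomial with exponent `a` and the signature `σ`. -/
noncomputable def Signature.mul {n : ℕ} (a : Fin n →₀ ℕ) (s : Signature n) : Signature n :=
  ⟨s.ind, a + s.mon⟩

/-- `σ` divides `τ` if `a σ = τ` for some monomial `a`. -/
def Signature.Divides {n : ℕ} (s t : Signature n) : Prop :=
  ∃ a : Fin n →₀ ℕ, Signature.mul a s = t

/-- The data of an extended sig-poly pair `(poly, sig, quo)`. -/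
structure SigPoly (n : ℕ) (K : Type*) [Field K] where
  poly : MvPolynomial (Fin n) K
  sig : Signature n
  quo : MvPolynomial (Fin n) K

/-- The state of an sGB tree.

* The rooted tree is given by the finite set `nodes` of its labels and by the map `parent`
  (`none` at the root); `val ν` is the polynomial held by the node `ν`.
* `G` lists the sig-poly pairs in the order in which they were added: an entry was added later
  than another one if its position is larger.
* `P` is the set of S-pairs that are still to be processed, as pairs of positions in `G`.
* `S ν` is the set of recorded syzygies at `ν`. -/
structure Tree (n : ℕ) (K : Type*) [Field K] where
  nodes : Finset ℕ
  parent : ℕ → Option ℕ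
  val : ℕ → MvPolynomial (Fin n) K
  G : List (SigPoly n K)
  P : Set (ℕ × ℕ)
  S : ℕ → Set (MvPolynomial (Fin n) K)

/-- The exponent `a` with `a + deg f = lcm (deg f, deg g)`, where `deg` is the exponent of the
leading monomial. -/
noncomputable def cofactor {n : ℕ} {K : Type*} [Field K] (m : MonomialOrder (Fin n))
    (f g : MvPolynomial (Fin n) K) : Fin n →₀ ℕ :=
  (m.degree f ⊔ m.degree g) - m.degree f

/-- The term `lcm (lm f, lm g) / lt f`. -/
noncomputable def cofactorTerm {n : ℕ} {K : Type*} [Field K] (m : MonomialOrder (Fin n))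
    (f g : MvPolynomial (Fin n) K) : MvPolynomial (Fin n) K :=
  MvPolynomial.monomial (cofactor m f g) (m.leadingCoeff f)⁻¹

namespace Tree

variable {n : ℕ} {K : Type*} [Field K]

/-- The ancestor-descendant relation: `μ ≤_T ν` if `μ` is on the path from `ν` to the root. -/
def Le (T : Tree n K) (μ ν : ℕ) : Prop :=
  Relation.ReflTransGen (fun a b => T.parent b = some a) μ ν

/-- The strict ancestor relation. -/
def Lt (T : Tree n K) (μ ν : ℕ) : Prop := T.Le μ ν ∧ μ ≠ ν

/-- The ideal `I_ν` generated by the polynomials at the nodes on the path from the root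
to `ν`, both ends included. -/
noncomputable def pathIdeal (T : Tree n K) (ν : ℕ) : Ideal (MvPolynomial (Fin n) K) :=
  Ideal.span {f | ∃ μ ∈ T.nodes, T.Le μ ν ∧ T.val μ = f}

/-- The lexicographic order on signatures (partial, as the order on the indices is). -/
def SigLt (T : Tree n K) (m : MonomialOrder (Fin n)) (s t : Signature n) : Prop :=
  T.Lt s.ind t.ind ∨ (s.ind = t.ind ∧ s.mon ≺[m] t.mon)

/-- `α` and `β` form a regular S-pair: both polynomial parts have a leading monomial, the indices
are comparable, and `𝔰(a α) ≠ 𝔰(b β)`. -/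
def Regular (T : Tree n K) (m : MonomialOrder (Fin n)) (α β : SigPoly n K) : Prop :=
  α.poly ≠ 0 ∧ β.poly ≠ 0 ∧ (T.Le α.sig.ind β.sig.ind ∨ T.Le β.sig.ind α.sig.ind) ∧
    Signature.mul (cofactor m α.poly β.poly) α.sig ≠
      Signature.mul (cofactor m β.poly α.poly) β.sig

open Classical in
/-- The S-pair of `α` and `β` for `𝔰(α) > 𝔰(β)`. -/
noncomputable def sPairOrdered (T : Tree n K) (m : MonomialOrder (Fin n)) (α β : SigPoly n K) :
    SigPoly n K where
  poly := cofactorTerm m α.poly β.poly * α.poly - cofactorTerm m β.poly α.poly * β.poly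
  sig :=
    if T.SigLt m (Signature.mul (cofactor m α.poly β.poly) α.sig)
        (Signature.mul (cofactor m β.poly α.poly) β.sig)
    then Signature.mul (cofactor m β.poly α.poly) β.sig
    else Signature.mul (cofactor m α.poly β.poly) α.sig
  quo :=
    if α.sig.ind = β.sig.ind
    then cofactorTerm m α.poly β.poly * α.quo - cofactorTerm m β.poly α.poly * β.quo
    else cofactorTerm m α.poly β.poly * α.quo

open Classical in
/-- The S-pair of two sig-poly pairs: the element of larger signature comes first. -/
noncomputable def sPair (T : Tree n K) (m : MonomialOrder (Fin n)) (α β : SigPoly n K) :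
    SigPoly n K :=
  if T.SigLt m α.sig β.sig then T.sPairOrdered m β α else T.sPairOrdered m α β

/-- The rewritability criterion for `a α`, where `α` is the entry of `G` at position `i`:
the singular, the syzygy and the Koszul criterion. -/
def Rewritable (T : Tree n K) (m : MonomialOrder (Fin n)) (i : ℕ) (α : SigPoly n K)
    (a : Fin n →₀ ℕ) : Prop :=
  ∃ (j : ℕ) (δ : SigPoly n K), T.G[j]? = some δ ∧
    ((δ.sig.Divides (Signature.mul a α.sig) ∧ i < j) ∨
     (δ.sig.Divides (Signature.mul a α.sig) ∧ δ.poly = 0) ∨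
     (T.Lt δ.sig.ind α.sig.ind ∧ δ.poly ≠ 0 ∧ m.degree δ.poly ≤ m.degree α.quo))

open Classical in
/-- One iteration of the loop of regular reduction modulo `G`: the leading term of the polynomial
part of `γ` is cancelled by `b β` for some `β ∈ G` with `𝔰(b β) < 𝔰(γ)`. -/
def ReduceStep (T : Tree n K) (m : MonomialOrder (Fin n)) (γ γ' : SigPoly n K) : Prop :=
  ∃ β ∈ T.G, γ.poly ≠ 0 ∧ β.poly ≠ 0 ∧ m.degree β.poly ≤ m.degree γ.poly ∧
    T.SigLt m (Signature.mul (m.degree γ.poly - m.degree β.poly) β.sig) γ.sig ∧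
    γ'.sig = γ.sig ∧
    γ'.poly = γ.poly - MvPolynomial.monomial (m.degree γ.poly - m.degree β.poly)
      (m.leadingCoeff γ.poly / m.leadingCoeff β.poly) * β.poly ∧
    γ'.quo = if β.sig.ind = γ.sig.ind
      then γ.quo - MvPolynomial.monomial (m.degree γ.poly - m.degree β.poly)
        (m.leadingCoeff γ.poly / m.leadingCoeff β.poly) * β.quo
      else γ.quo

/-- Append `γ` to `G`, and to `P` all the regular S-pairs of `γ` with the elements of `G`. -/
def addWithPairs (T : Tree n K) (m : MonomialOrder (Fin n)) (γ : SigPoly n K) : Tree n K :=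
  { T with
    G := T.G ++ [γ]
    P := T.P ∪ {p | p.1 = T.G.length ∧ ∃ β, T.G[p.2]? = some β ∧ T.Regular m γ β} }

open Classical in
/-- Insertion of the result `γ` of a regular reduction: if its polynomial part is nonzero then the
new S-pairs are created, otherwise its quotient is recorded as a syzygy. -/
noncomputable def addReduced (T : Tree n K) (m : MonomialOrder (Fin n)) (γ : SigPoly n K) :
    Tree n K :=
  if γ.poly ≠ 0 then T.addWithPairs m γ
  else { T with
    G := T.G ++ [γ]
    S := Function.update T.S γ.sig.ind (T.S γ.sig.ind ∪ {γ.quo}) }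

/-- `α`, `β` are the members of the pair `p` of `P`, and their indices are `≤_T ν`. -/
def PairBelow (T : Tree n K) (ν : ℕ) (p : ℕ × ℕ) (α β : SigPoly n K) : Prop :=
  p ∈ T.P ∧ T.G[p.1]? = some α ∧ T.G[p.2]? = some β ∧ T.Le α.sig.ind ν ∧ T.Le β.sig.ind ν

/-- There is a pair in `P` with index `≤_T ν`. -/
def HasPair (T : Tree n K) (ν : ℕ) : Prop := ∃ p α β, T.PairBelow ν p α β

/-- `p = (α, β)` is a pair in `P` of index `≤_T ν` whose S-pair has minimal signature. -/
def MinPair (T : Tree n K) (m : MonomialOrder (Fin n)) (ν : ℕ) (p : ℕ × ℕ) (α β : SigPoly n K) :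
    Prop :=
  T.PairBelow ν p α β ∧
    ∀ p' α' β', T.PairBelow ν p' α' β' →
      ¬ T.SigLt m (T.sPair m α' β').sig (T.sPair m α β).sig

/-- The S-pair `p = (α, β)` passes the rewritability check. -/
def PassesCheck (T : Tree n K) (m : MonomialOrder (Fin n)) (p : ℕ × ℕ) (α β : SigPoly n K) :
    Prop :=
  ¬ T.Rewritable m p.1 α (cofactor m α.poly β.poly) ∧
    ¬ T.Rewritable m p.2 β (cofactor m β.poly α.poly)

end Tree

/-- Configurations of a running procedure on an sGB tree with results in `ρ`: at the head of the
main loop; inside regular reduction, with current element `γ`; or returned. -/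
inductive Config (n : ℕ) (K : Type*) [Field K] (ρ : Type*) where
  | loop (T : Tree n K) : Config n K ρ
  | reducing (T : Tree n K) (γ : SigPoly n K) : Config n K ρ
  | returned (T : Tree n K) (out : ρ) : Config n K ρ

/-- The elementary steps of a loop `while guard do ProcessSPair(T, ν)`.  The relation is
nondeterministic as the choices of a minimal pair and of a reducer are free. -/
inductive LoopStep {n : ℕ} {K : Type*} [Field K] {ρ : Type*} (m : MonomialOrder (Fin n)) (ν : ℕ)
    (guard : Tree n K → Prop) : Config n K ρ → Config n K ρ → Prop
  | discard (T : Tree n K) (p : ℕ × ℕ) (α β : SigPoly n K) (hg : guard T)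
      (hp : T.MinPair m ν p α β) (hc : ¬ T.PassesCheck m p α β) :
      LoopStep m ν guard (.loop T) (.loop { T with P := T.P \ {p} })
  | select (T : Tree n K) (p : ℕ × ℕ) (α β : SigPoly n K) (hg : guard T)
      (hp : T.MinPair m ν p α β) (hc : T.PassesCheck m p α β) :
      LoopStep m ν guard (.loop T) (.reducing { T with P := T.P \ {p} } (T.sPair m α β))
  | reduce (T : Tree n K) (γ γ' : SigPoly n K) (h : T.ReduceStep m γ γ') :
      LoopStep m ν guard (.reducing T γ) (.reducing T γ')
  | insert (T : Tree n K) (γ : SigPoly n K) (h : ∀ γ', ¬ T.ReduceStep m γ γ') :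
      LoopStep m ν guard (.reducing T γ) (.loop (T.addReduced m γ))

/-- The elementary steps of `Basis(T, ν)`. -/
inductive BasisStep {n : ℕ} {K : Type*} [Field K] (m : MonomialOrder (Fin n)) (ν : ℕ) :
    Config n K (Set (MvPolynomial (Fin n) K)) → Config n K (Set (MvPolynomial (Fin n) K)) → Prop
  | body (c c' : Config n K (Set (MvPolynomial (Fin n) K)))
      (h : LoopStep m ν (fun T => T.HasPair ν) c c') : BasisStep m ν c c'
  | ret (T : Tree n K) (h : ¬ T.HasPair ν) :
      BasisStep m ν (.loop T) (.returned T {f | ∃ α ∈ T.G, T.Le α.sig.ind ν ∧ α.poly = f})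

/-- The elementary steps of `GetSyzygy(T, ν)`. -/
inductive GetSyzygyStep {n : ℕ} {K : Type*} [Field K] (m : MonomialOrder (Fin n)) (ν : ℕ) :
    Config n K (MvPolynomial (Fin n) K) → Config n K (MvPolynomial (Fin n) K) → Prop
  | body (c c' : Config n K (MvPolynomial (Fin n) K))
      (h : LoopStep m ν (fun T => T.HasPair ν ∧ T.S ν = ∅) c c') : GetSyzygyStep m ν c c'
  | pick (T : Tree n K) (f : MvPolynomial (Fin n) K) (hf : f ∈ T.S ν) :
      GetSyzygyStep m ν (.loop T)
        (.returned { T with S := Function.update T.S ν (T.S ν \ {f}) } f)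
  | zero (T : Tree n K) (h : ¬ T.HasPair ν) (hS : T.S ν = ∅) :
      GetSyzygyStep m ν (.loop T) (.returned T 0)

/-- The position of a new node: the root of an empty tree, a new leaf below `μ`, or just above `μ`
(on the edge between `μ` and its parent, or as a new root if `μ` is the root). -/
inductive Position where
  | root : Position
  | child (μ : ℕ) : Position
  | above (μ : ℕ) : Position

namespace Tree

variable {n : ℕ} {K : Type*} [Field K]

/-- The empty sGB tree. -/
noncomputable def empty (n : ℕ) (K : Type*) [Field K] : Tree n K where
  nodes := ∅
  parent := fun _ => none
  val := fun _ => 0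
  G := []
  P := ∅
  S := fun _ => ∅

/-- The position makes sense in `T`. -/
def ValidPosition (T : Tree n K) : Position → Prop
  | .root => T.nodes = ∅
  | .child μ => μ ∈ T.nodes
  | .above μ => μ ∈ T.nodes

/-- The label of the next node: the largest label plus one. -/
def newLabel (T : Tree n K) : ℕ := T.nodes.sup id + 1

/-- The parent map after the insertion of the node `T.newLabel`. -/
def newParent (T : Tree n K) : Position → ℕ → Option ℕ
  | .root => Function.update T.parent T.newLabel none
  | .child μ => Function.update T.parent T.newLabel (some μ)
  | .above μ =>
      Function.update (Function.update T.parent T.newLabel (T.parent μ)) μ (some T.newLabel)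

/-- `InsertNode(T, f, pos)`: after the new node `ν` is put in the tree, the sig-poly pair
`(f, (ν, 1), 1)` is added to `G`, and its regular S-pairs are added to `P`. -/
noncomputable def insertNode (T : Tree n K) (m : MonomialOrder (Fin n))
    (f : MvPolynomial (Fin n) K) (pos : Position) : Tree n K :=
  addWithPairs
    { T with
      nodes := insert T.newLabel T.nodes
      parent := T.newParent pos
      val := Function.update T.val T.newLabel f
      S := Function.update T.S T.newLabel ∅ }
    m ⟨f, ⟨T.newLabel, 0⟩, 1⟩

/-- The states that result from a finite sequence of calls to `InsertNode`, `Basis` and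
`GetSyzygy`, applied to the empty tree. -/
inductive Reachable (m : MonomialOrder (Fin n)) : Tree n K → Prop
  | empty : Reachable m (Tree.empty n K)
  | insertNode (T : Tree n K) (f : MvPolynomial (Fin n) K) (pos : Position)
      (hT : Reachable m T) (hpos : T.ValidPosition pos) : Reachable m (T.insertNode m f pos)
  | basis (T T' : Tree n K) (ν : ℕ) (out : Set (MvPolynomial (Fin n) K)) (hT : Reachable m T)
      (hν : ν ∈ T.nodes)
      (h : Relation.ReflTransGen (BasisStep m ν) (.loop T) (.returned T' out)) : Reachable m T'
  | getSyzygy (T T' : Tree n K) (ν : ℕ) (out : MvPolynomial (Fin n) K) (hT : Reachable m T)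
      (hν : ν ∈ T.nodes)
      (h : Relation.ReflTransGen (GetSyzygyStep m ν) (.loop T) (.returned T' out)) :
      Reachable m T'

end Tree

end SigGB

/-! Each entry of `G` stands for an element of the free module on the nodes. `IsSig` records what is
needed of this element: `quo` is its coefficient at the index, its leading monomial is that of the
signature, and the coefficients at strict ancestors enter only through the ideal `below`. Inserting
a node can only enlarge these ideals and keeps the order of the old nodes, so nothing recorded
earlier is lost.

Correctness rests on `exists_reducer`: if every regular S-pair of signature at most `σ` has a
rewritable component, then each nonzero `p` of signature at most `σ` has the leading monomial of a
non-rewritable `b β` of signature at most `σ`. The proof is by induction on `σ`. Take the last `δ`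
in `G` whose signature divides `σ`, say `𝔰(a δ) = σ`. If `a δ` is rewritable, this is due to a
syzygy of signature `σ`, and subtracting a multiple of it lowers the signature of `p`. Otherwise
subtract a multiple of `a δ` instead. The remainder has smaller signature and cannot share the
leading monomial of `a δ`: it would share it with a non-rewritable `b β` of smaller signature, and
the S-pair of `δ` and `β` would have no rewritable component. So the leading monomial of `p` comes
from `a δ` or, by induction, from the remainder.

The invariant `Inv` says that every regular S-pair is still in `P` or has a rewritable component.
When no pair with indices `≤_T ν` is left, `exists_reducer` therefore applies to all of `I_ν`.

Termination compares the ratios of signature to leading monomial. A nonzero result of an S-pair has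
a larger ratio than both members of the pair (`MinPair.ratioLt`). Since the pair has minimal
signature and the reduction is complete, divisibility of signature and leading monomial by those of
an earlier entry of the same index forces equal ratios (`MinPair.ratioEq_of_le`). By Dickson's lemma
only finitely many ratios occur. Inductively each of them occurs finitely often, because the entries
come from distinct pairs of entries of smaller ratio (`not_infinite_sequence`). Minimality and
irreducibility are needed only here, not for correctness. -/

namespace SigGB

open MvPolynomial

variable {n : ℕ} {K : Type*} [Field K]

/-! ### The order of the tree and of the signatures -/

/-- The parent map describes a forest on the set of nodes. -/
structure Tree.WellFormed (T : Tree n K) : Prop where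
  depth : ∃ d : ℕ → ℕ, ∀ a b, T.parent b = some a → d a < d b
  parent_mem : ∀ a b, T.parent b = some a → a ∈ T.nodes ∧ b ∈ T.nodes

namespace Tree

variable {T : Tree n K} {m : MonomialOrder (Fin n)}

theorem Le.refl (a : ℕ) : T.Le a a := Relation.ReflTransGen.refl

theorem Le.trans {a b c : ℕ} (h : T.Le a b) (h' : T.Le b c) : T.Le a c :=
  Relation.ReflTransGen.trans h h'

theorem Le.of_parent {a b : ℕ} (h : T.parent b = some a) : T.Le a b :=
  Relation.ReflTransGen.single h

theorem Le.eq_or_depth_lt {d : ℕ → ℕ} (hd : ∀ a b, T.parent b = some a → d a < d b) {a b : ℕ}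
    (h : T.Le a b) : a = b ∨ d a < d b := by
  induction h with
  | refl => exact Or.inl rfl
  | tail _ h ih =>
    right
    have := hd _ _ h
    rcases ih with rfl | ih <;> omega

theorem Le.antisymm (hT : T.WellFormed) {a b : ℕ} (h : T.Le a b) (h' : T.Le b a) : a = b := by
  obtain ⟨d, hd⟩ := hT.depth
  rcases h.eq_or_depth_lt hd with h | h
  · exact h
  · rcases h'.eq_or_depth_lt hd with h' | h'
    · exact h'.symm
    · omega

theorem Le.mem (hT : T.WellFormed) {a b : ℕ} (h : T.Le a b) (hb : b ∈ T.nodes) :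
    a ∈ T.nodes := by
  rcases Relation.ReflTransGen.cases_head h with rfl | ⟨c, hc, _⟩
  · exact hb
  · exact (hT.parent_mem _ _ hc).1

theorem Lt.trans_le (hT : T.WellFormed) {a b c : ℕ} (h : T.Lt a b) (h' : T.Le b c) :
    T.Lt a c :=
  ⟨h.1.trans h', fun e => h.2 (h.1.antisymm hT (e ▸ h'))⟩

theorem Le.trans_lt (hT : T.WellFormed) {a b c : ℕ} (h : T.Le a b) (h' : T.Lt b c) :
    T.Lt a c :=
  ⟨h.trans h'.1, fun e => h'.2 (h'.1.antisymm hT (e ▸ h))⟩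

theorem lt_iff_of_parent (hT : T.WellFormed) {κ μ π : ℕ} (h : T.parent μ = some π) :
    T.Lt κ μ ↔ T.Le κ π := by
  constructor
  · rintro ⟨h₁, h₂⟩
    rcases Relation.ReflTransGen.cases_tail h₁ with h₃ | ⟨e, he, he'⟩
    · exact absurd h₃.symm h₂
    · rw [h] at he'
      obtain rfl := Option.some.inj he'
      exact he
  · intro h₁
    refine h₁.trans_lt hT ⟨Le.of_parent h, ?_⟩
    rintro rfl
    obtain ⟨d, hd⟩ := hT.depth
    exact lt_irrefl _ (hd _ _ h)

theorem not_lt_of_parent_eq_none {κ μ : ℕ} (h : T.parent μ = none) : ¬ T.Lt κ μ := by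
  rintro ⟨h₁, h₂⟩
  rcases Relation.ReflTransGen.cases_tail h₁ with h₃ | ⟨e, he, he'⟩
  · exact h₂ h₃.symm
  · rw [h] at he'
    cases he'

theorem SigLt.ind_le {s t : Signature n} (h : T.SigLt m s t) : T.Le s.ind t.ind := by
  rcases h with h | h
  · exact h.1
  · rw [h.1]
    exact Le.refl _

theorem SigLt.trans (hT : T.WellFormed) {s t u : Signature n} (h : T.SigLt m s t)
    (h' : T.SigLt m t u) : T.SigLt m s u := by
  rcases h with h | h
  · exact Or.inl (h.trans_le hT h'.ind_le)
  · rcases h' with h' | h'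
    · left
      rw [h.1]
      exact h'
    · exact Or.inr ⟨h.1.trans h'.1, h.2.trans h'.2⟩

theorem SigLt.irrefl (s : Signature n) : ¬ T.SigLt m s s := by
  rintro (h | h)
  · exact h.2 rfl
  · exact lt_irrefl _ h.2

theorem SigLt.asymm (hT : T.WellFormed) {s t : Signature n} (h : T.SigLt m s t) :
    ¬ T.SigLt m t s :=
  fun h' => SigLt.irrefl s (h.trans hT h')

/-- Signatures with comparable indices are comparable. -/
theorem sigLt_trichotomy {s t : Signature n} (h : T.Le s.ind t.ind ∨ T.Le t.ind s.ind) :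
    T.SigLt m s t ∨ s = t ∨ T.SigLt m t s := by
  by_cases e : s.ind = t.ind
  · rcases lt_trichotomy (m.toSyn s.mon) (m.toSyn t.mon) with h' | h' | h'
    · exact Or.inl (Or.inr ⟨e, h'⟩)
    · exact Or.inr (Or.inl (Signature.ext e (m.toSyn.injective h')))
    · exact Or.inr (Or.inr (Or.inr ⟨e.symm, h'⟩))
  · rcases h with h | h
    · exact Or.inl (Or.inl ⟨h, e⟩)
    · exact Or.inr (Or.inr (Or.inl ⟨h, Ne.symm e⟩))

/-- The order refines into the lexicographic order on depth in the tree and monomial, both of which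
are well-founded. -/
theorem sigLt_wellFounded (hT : T.WellFormed) : WellFounded (T.SigLt m) := by
  obtain ⟨d, hd⟩ := hT.depth
  refine Subrelation.wf (r := InvImage (Prod.Lex (· < ·) (· < ·))
    (fun s : Signature n => (d s.ind, m.toSyn s.mon))) ?_ (InvImage.wf _ ?_)
  · intro s t h
    rcases h with h | h
    · exact Prod.Lex.left _ _ ((h.1.eq_or_depth_lt hd).resolve_left h.2)
    · simp only [InvImage, h.1]
      exact Prod.Lex.right _ h.2
  · exact WellFounded.prod_lex wellFounded_lt wellFounded_lt

theorem sigLt_mul_iff {a : Fin n →₀ ℕ} {s t : Signature n} :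
    T.SigLt m (Signature.mul a s) (Signature.mul a t) ↔ T.SigLt m s t := by
  simp [SigLt, Signature.mul]

theorem sigLt_mul_self {a : Fin n →₀ ℕ} (s : Signature n) :
    T.SigLt m s (Signature.mul a s) ∨ s = Signature.mul a s := by
  by_cases h : a = 0
  · right
    subst h
    simp [Signature.mul]
  · left
    right
    refine ⟨rfl, ?_⟩
    simp only [Signature.mul, map_add]
    have : 0 < m.toSyn a := by
      rw [MonomialOrder.toSyn_lt_iff_ne_zero, Ne, MonomialOrder.toSyn_eq_zero_iff]
      exact h
    exact lt_add_of_pos_left _ this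

end Tree

theorem Signature.mul_mul (a b : Fin n →₀ ℕ) (s : Signature n) :
    Signature.mul a (Signature.mul b s) = Signature.mul (a + b) s := by
  simp [Signature.mul, add_assoc]

theorem Signature.Divides.mul {s t : Signature n} (h : s.Divides t) (a : Fin n →₀ ℕ) :
    s.Divides (Signature.mul a t) := by
  obtain ⟨b, rfl⟩ := h
  exact ⟨a + b, (Signature.mul_mul a b s).symm⟩

/-- The first two criteria are divisibilities of signatures, and the Koszul criterion does not
involve the multiplier. This carries rewritability from the component of an S-pair to its multiples.
-/
theorem Tree.Rewritable.mul {T : Tree n K} {m : MonomialOrder (Fin n)} {i : ℕ} {α : SigPoly n K}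
    {a : Fin n →₀ ℕ} (h : T.Rewritable m i α a) (b : Fin n →₀ ℕ) :
    T.Rewritable m i α (b + a) := by
  obtain ⟨j, δ, hj, h⟩ := h
  refine ⟨j, δ, hj, ?_⟩
  rw [← Signature.mul_mul]
  rcases h with h | h | h
  · exact Or.inl ⟨h.1.mul b, h.2⟩
  · exact Or.inr (Or.inl ⟨h.1.mul b, h.2⟩)
  · exact Or.inr (Or.inr h)

/-! ### Leading monomials -/

section degree

variable (m : MonomialOrder (Fin n))

theorem degree_monomial_mul {q : MvPolynomial (Fin n) K} {a : Fin n →₀ ℕ} {c : K} (hc : c ≠ 0)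
    (hq : q ≠ 0) : m.degree (monomial a c * q) = a + m.degree q := by
  classical
  rw [m.degree_mul (by simpa using hc) hq, m.degree_monomial, if_neg hc]

theorem monomial_mul_ne_zero {q : MvPolynomial (Fin n) K} {a : Fin n →₀ ℕ} {c : K} (hc : c ≠ 0)
    (hq : q ≠ 0) : monomial a c * q ≠ 0 :=
  mul_ne_zero (by simpa using hc) hq

/-- If `q` and `s` have degree at most `d`, and `s` has degree `d`, then a multiple of `s` cancels
the coefficient of `q` at `d`. -/
theorem exists_cancel {q s : MvPolynomial (Fin n) K} {d : Fin n →₀ ℕ}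
    (hq : ∀ e ∈ q.support, e ≼[m] d) (hs : s ≠ 0) (hd : m.degree s = d) :
    ∃ c : K, ∀ e ∈ (q - C c * s).support, e ≺[m] d := by
  refine ⟨q.coeff d / m.leadingCoeff s, fun e he => ?_⟩
  have hle : e ≼[m] d := by
    have := MvPolynomial.support_sub _ _ _ he
    rcases Finset.mem_union.1 this with h | h
    · exact hq e h
    · rw [← smul_eq_C_mul] at h
      exact hd ▸ m.le_degree (MvPolynomial.support_smul h)
  refine lt_of_le_of_ne hle fun h => ?_
  obtain rfl := m.toSyn.injective h
  rw [mem_support_iff, coeff_sub, coeff_C_mul] at he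
  apply he
  have h₁ : s.coeff e = m.leadingCoeff s := by rw [← hd]; rfl
  rw [h₁, div_mul_cancel₀ _ (m.leadingCoeff_ne_zero_iff.2 hs), sub_self]

end degree

/-! ### Ideals along a path and signatures of their elements -/

namespace Tree

/-- The ideal generated by the polynomials at the strict ancestors of `μ`. -/
noncomputable def below (T : Tree n K) (μ : ℕ) : Ideal (MvPolynomial (Fin n) K) :=
  Ideal.span {f | ∃ κ ∈ T.nodes, T.Lt κ μ ∧ T.val κ = f}

/-- `p` is the image of an element of the free module on the nodes whose signature is at
most `σ`. -/
def Spans (T : Tree n K) (m : MonomialOrder (Fin n)) (σ : Signature n)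
    (p : MvPolynomial (Fin n) K) : Prop :=
  ∃ q : MvPolynomial (Fin n) K, (∀ c ∈ q.support, c ≼[m] σ.mon) ∧
    p - q * T.val σ.ind ∈ T.below σ.ind

/-- The signature and the quotient of `α` are those of a module element with image `α.poly`. -/
structure IsSig (T : Tree n K) (m : MonomialOrder (Fin n)) (α : SigPoly n K) : Prop where
  mem : α.sig.ind ∈ T.nodes
  quo_ne_zero : α.quo ≠ 0
  degree_quo : m.degree α.quo = α.sig.mon
  sub_mem : α.poly - α.quo * T.val α.sig.ind ∈ T.below α.sig.ind

variable {T : Tree n K} {m : MonomialOrder (Fin n)}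

theorem pathIdeal_eq {μ : ℕ} (hμ : μ ∈ T.nodes) :
    T.pathIdeal μ = Ideal.span {T.val μ} ⊔ T.below μ := by
  rw [below, ← Ideal.span_union, pathIdeal]
  congr 1
  ext f
  constructor
  · rintro ⟨κ, h₁, h₂, rfl⟩
    by_cases e : κ = μ
    · left
      rw [e]
      rfl
    · exact Or.inr ⟨κ, h₁, ⟨h₂, e⟩, rfl⟩
  · rintro (h | ⟨κ, h₁, h₂, rfl⟩)
    · exact ⟨μ, hμ, Le.refl _, h.symm⟩
    · exact ⟨κ, h₁, h₂.1, rfl⟩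

theorem mem_pathIdeal_iff {μ : ℕ} (hμ : μ ∈ T.nodes)
    {p : MvPolynomial (Fin n) K} :
    p ∈ T.pathIdeal μ ↔ ∃ q, p - q * T.val μ ∈ T.below μ := by
  rw [pathIdeal_eq hμ, Submodule.mem_sup]
  constructor
  · rintro ⟨y, hy, z, hz, rfl⟩
    obtain ⟨q, rfl⟩ := Ideal.mem_span_singleton'.1 hy
    exact ⟨q, by simpa using hz⟩
  · rintro ⟨q, hq⟩
    exact ⟨_, Ideal.mem_span_singleton'.2 ⟨q, rfl⟩, _, hq, by ring⟩

theorem pathIdeal_mono {μ ν : ℕ} (h : T.Le μ ν) : T.pathIdeal μ ≤ T.pathIdeal ν := by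
  refine Ideal.span_mono ?_
  rintro f ⟨κ, h₁, h₂, rfl⟩
  exact ⟨κ, h₁, h₂.trans h, rfl⟩

theorem pathIdeal_le_below (hT : T.WellFormed) {μ ν : ℕ} (h : T.Lt μ ν) :
    T.pathIdeal μ ≤ T.below ν := by
  refine Ideal.span_mono ?_
  rintro f ⟨κ, h₁, h₂, rfl⟩
  exact ⟨κ, h₁, h₂.trans_lt hT h, rfl⟩

theorem IsSig.mem_pathIdeal {α : SigPoly n K} (h : T.IsSig m α) :
    α.poly ∈ T.pathIdeal α.sig.ind :=
  (mem_pathIdeal_iff h.mem).2 ⟨_, h.sub_mem⟩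

theorem exists_spans {μ : ℕ} (hμ : μ ∈ T.nodes)
    {p : MvPolynomial (Fin n) K} (hp : p ∈ T.pathIdeal μ) :
    ∃ d, T.Spans m ⟨μ, d⟩ p := by
  obtain ⟨q, hq⟩ := (mem_pathIdeal_iff hμ).1 hp
  exact ⟨m.degree q, q, fun c hc => m.le_degree hc, hq⟩

/-- A nonzero element of the ideal of the strict ancestors has a smaller signature. -/
theorem exists_spans_of_mem_below (hT : T.WellFormed) {μ : ℕ}
    {p : MvPolynomial (Fin n) K} (hp : p ∈ T.below μ) (hp0 : p ≠ 0) :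
    ∃ τ : Signature n, T.Lt τ.ind μ ∧ T.Spans m τ p := by
  -- The strict ancestors of `μ` are the nodes on the path to its parent, so `below μ` is the path
  -- ideal of the parent, or zero at a root.
  rcases h : T.parent μ with _ | π
  · have : T.below μ = ⊥ := by
      rw [below, Ideal.span_eq_bot]
      rintro f ⟨κ, _, h', _⟩
      exact absurd h' (not_lt_of_parent_eq_none h)
    rw [this] at hp
    exact absurd hp hp0
  · have hπ := (hT.parent_mem _ _ h).1
    have : p ∈ T.pathIdeal π := by
      have e : T.below μ = T.pathIdeal π := by
        simp only [below, pathIdeal, lt_iff_of_parent hT h]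
      rwa [e] at hp
    obtain ⟨d, hd⟩ := exists_spans (m := m) hπ this
    exact ⟨⟨π, d⟩, (lt_iff_of_parent hT h).2 (Le.refl _), hd⟩

/-- A nonzero polynomial all of whose module monomials are below `σ` has a smaller signature. -/
theorem exists_spans_lt (hT : T.WellFormed) {σ : Signature n} {p q : MvPolynomial (Fin n) K}
    (hp0 : p ≠ 0) (hq : ∀ c ∈ q.support, c ≺[m] σ.mon)
    (hp : p - q * T.val σ.ind ∈ T.below σ.ind) : ∃ τ, T.SigLt m τ σ ∧ T.Spans m τ p := by
  by_cases h0 : q = 0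
  · rw [h0, zero_mul, sub_zero] at hp
    obtain ⟨τ, h₁, h₂⟩ := exists_spans_of_mem_below hT hp hp0
    exact ⟨τ, Or.inl h₁, h₂⟩
  · exact ⟨⟨σ.ind, m.degree q⟩, Or.inr ⟨rfl, hq _ (m.degree_mem_support h0)⟩, q,
      fun c hc => m.le_degree hc, hp⟩

end Tree

/-! ### Bases in which all regular S-pairs are rewritable -/

/-- Both leading monomials divide `d`, hence so does their lcm, and `t` is the quotient. Two
multiples of `f` and `g` with equal leading monomial are thus `t` times the components of the
S-pair. -/
theorem exists_common_cofactor (m : MonomialOrder (Fin n)) {f g : MvPolynomial (Fin n) K}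
    {d : Fin n →₀ ℕ} (hf : m.degree f ≤ d) (hg : m.degree g ≤ d) :
    ∃ t, d - m.degree f = t + cofactor m f g ∧ d - m.degree g = t + cofactor m g f := by
  refine ⟨d - (m.degree f ⊔ m.degree g), ?_, ?_⟩ <;>
  · ext i
    have h₁ := hf i
    have h₂ := hg i
    simp only [cofactor, Finsupp.coe_add, Finsupp.coe_tsub, Pi.add_apply, Pi.sub_apply,
      Finsupp.sup_apply]
    omega

namespace Tree

variable {T : Tree n K} {m : MonomialOrder (Fin n)}

/-- The regular S-pairs with signature at most `σ` have a rewritable component. -/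
def RewritablePairs (T : Tree n K) (m : MonomialOrder (Fin n)) (σ : Signature n) : Prop :=
  ∀ i j α β, T.G[i]? = some α → T.G[j]? = some β → α.poly ≠ 0 → β.poly ≠ 0 →
    T.SigLt m (Signature.mul (cofactor m β.poly α.poly) β.sig)
      (Signature.mul (cofactor m α.poly β.poly) α.sig) →
    (T.SigLt m (Signature.mul (cofactor m α.poly β.poly) α.sig) σ ∨
      Signature.mul (cofactor m α.poly β.poly) α.sig = σ) →
    T.Rewritable m i α (cofactor m α.poly β.poly) ∨ T.Rewritable m j β (cofactor m β.poly α.poly)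

theorem RewritablePairs.mono (hT : T.WellFormed) {σ τ : Signature n}
    (h : T.RewritablePairs m σ) (hτ : T.SigLt m τ σ) : T.RewritablePairs m τ := by
  intro i j α β hi hj hα hβ hlt hle
  refine h i j α β hi hj hα hβ hlt (Or.inl ?_)
  rcases hle with hle | hle
  · exact hle.trans hT hτ
  · rwa [hle]

/-- The last entry of the basis whose signature divides `σ`. -/
theorem exists_last_divides (hU : ∀ μ ∈ T.nodes, ∃ α ∈ T.G, α.sig = ⟨μ, 0⟩) {σ : Signature n}
    (hσ : σ.ind ∈ T.nodes) :
    ∃ (i : ℕ) (δ : SigPoly n K), T.G[i]? = some δ ∧ δ.sig.Divides σ ∧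
      ∀ (j : ℕ) (δ' : SigPoly n K), T.G[j]? = some δ' → δ'.sig.Divides σ → j ≤ i := by
  obtain ⟨ε, hε, hε'⟩ := hU _ hσ
  obtain ⟨k, hk⟩ := List.mem_iff_getElem?.1 hε
  let D : Set ℕ := {i | ∃ δ : SigPoly n K, T.G[i]? = some δ ∧ δ.sig.Divides σ}
  have hfin : D.Finite := (Set.finite_lt_nat T.G.length).subset fun i hi => by
    obtain ⟨δ, h, _⟩ := hi
    exact (List.getElem?_eq_some_iff.1 h).1
  have hne : D.Nonempty := ⟨k, ε, hk, σ.mon, by rw [hε']; simp [Signature.mul]⟩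
  obtain ⟨i, ⟨δ, h₁, h₂⟩, hmax⟩ := Set.exists_max_image D id hfin hne
  exact ⟨i, δ, h₁, h₂, fun j δ' h₃ h₄ => hmax j ⟨δ', h₃, h₄⟩⟩

/-- If `a δ` is rewritable by the syzygy or the Koszul criterion, there is a syzygy of the same
signature, up to module elements with smaller index. -/
theorem exists_syzygy_of_rewritable (hT : T.WellFormed) (hG : ∀ α ∈ T.G, T.IsSig m α)
    {σ : Signature n} {i : ℕ} {δ : SigPoly n K} {a : Fin n →₀ ℕ} (hi : T.G[i]? = some δ)
    (ha : Signature.mul a δ.sig = σ)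
    (hlast : ∀ (j : ℕ) (δ' : SigPoly n K), T.G[j]? = some δ' → δ'.sig.Divides σ → j ≤ i)
    (h : T.Rewritable m i δ a) :
    ∃ s : MvPolynomial (Fin n) K, s ≠ 0 ∧ m.degree s = σ.mon ∧
      s * T.val σ.ind ∈ T.below σ.ind := by
  obtain ⟨j, δ', hj, h⟩ := h
  have hδ' := hG δ' (List.mem_of_getElem? hj)
  rw [ha] at h
  rcases h with ⟨h₁, h₂⟩ | ⟨⟨b, rfl⟩, h₂⟩ | ⟨h₁, h₂, h₃⟩
  · exact absurd (hlast j δ' hj h₁) (not_le.2 h₂)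
  -- Since `δ'.poly = 0`, the quotient of `δ'` is itself a syzygy modulo the ideal of the strict
  -- ancestors.
  · refine ⟨monomial b 1 * δ'.quo, monomial_mul_ne_zero one_ne_zero hδ'.quo_ne_zero, ?_, ?_⟩
    · rw [degree_monomial_mul m one_ne_zero hδ'.quo_ne_zero, hδ'.degree_quo]
      rfl
    · have := Ideal.mul_mem_left _ (-monomial b (1 : K)) hδ'.sub_mem
      rw [h₂] at this
      rw [show monomial b 1 * δ'.quo * T.val (Signature.mul b δ'.sig).ind =
        -monomial b (1 : K) * (0 - δ'.quo * T.val δ'.sig.ind) by simp only [Signature.mul]; ring]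
      exact this
  -- Koszul syzygy: `δ'.poly` lies in the ideal of the strict ancestors, so any multiple of it can
  -- serve as coefficient at `σ.ind`. Its leading monomial divides that of `δ.quo`, hence `σ.mon`,
  -- so some multiple has exactly the degree `σ.mon`.
  · have hδ := hG δ (List.mem_of_getElem? hi)
    subst ha
    have h₄ : m.degree δ'.poly ≤ a + δ.sig.mon := by
      rw [← hδ.degree_quo]
      exact h₃.trans le_add_self
    refine ⟨monomial (a + δ.sig.mon - m.degree δ'.poly) 1 * δ'.poly,
      monomial_mul_ne_zero one_ne_zero h₂, ?_, ?_⟩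
    · rw [degree_monomial_mul m one_ne_zero h₂, tsub_add_cancel_of_le h₄]
      rfl
    · refine Ideal.mul_mem_right _ _ (Ideal.mul_mem_left _ _ ?_)
      exact pathIdeal_le_below hT h₁ hδ'.mem_pathIdeal

/-- If the regular S-pairs up to the signature `σ` have a rewritable component, then the leading
monomial of each polynomial of signature at most `σ` is that of some `b β` that has signature at
most `σ` and that is not rewritable. -/
theorem exists_reducer (hT : T.WellFormed) (hG : ∀ α ∈ T.G, T.IsSig m α)
    (hU : ∀ μ ∈ T.nodes, ∃ α ∈ T.G, α.sig = ⟨μ, 0⟩) {σ : Signature n} (hσ : σ.ind ∈ T.nodes)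
    (hR : T.RewritablePairs m σ) {p : MvPolynomial (Fin n) K} (hp : p ≠ 0)
    (hs : T.Spans m σ p) :
    ∃ j β, T.G[j]? = some β ∧ β.poly ≠ 0 ∧ m.degree β.poly ≤ m.degree p ∧
      (T.SigLt m (Signature.mul (m.degree p - m.degree β.poly) β.sig) σ ∨
        Signature.mul (m.degree p - m.degree β.poly) β.sig = σ) ∧
      ¬ T.Rewritable m j β (m.degree p - m.degree β.poly) := by
  induction σ using (sigLt_wellFounded (m := m) hT).induction generalizing p with
  | _ σ ih =>
  have ih' : ∀ (p q : MvPolynomial (Fin n) K), p ≠ 0 → (∀ c ∈ q.support, c ≺[m] σ.mon) →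
      p - q * T.val σ.ind ∈ T.below σ.ind →
      ∃ j β, T.G[j]? = some β ∧ β.poly ≠ 0 ∧ m.degree β.poly ≤ m.degree p ∧
        T.SigLt m (Signature.mul (m.degree p - m.degree β.poly) β.sig) σ ∧
        ¬ T.Rewritable m j β (m.degree p - m.degree β.poly) := by
    intro p q hp hq hpq
    obtain ⟨τ, hτ, hτp⟩ := exists_spans_lt hT hp hq hpq
    obtain ⟨j, β, h₁, h₂, h₃, h₄, h₅⟩ :=
      ih τ hτ (hτ.ind_le.mem hT hσ) (hR.mono hT hτ) hp hτp
    refine ⟨j, β, h₁, h₂, h₃, ?_, h₅⟩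
    rcases h₄ with h₄ | h₄
    · exact h₄.trans hT hτ
    · rwa [h₄]
  obtain ⟨q, hq, hpq⟩ := hs
  -- Taking the last divisor excludes the singular criterion for `a δ`.
  obtain ⟨i, δ, hi, ⟨a, ha⟩, hlast⟩ := exists_last_divides hU hσ
  have hδ := hG δ (List.mem_of_getElem? hi)
  by_cases hrew : T.Rewritable m i δ a
  · obtain ⟨s, hs0, hs, hsm⟩ := exists_syzygy_of_rewritable hT hG hi ha hlast hrew
    obtain ⟨c, hc⟩ := exists_cancel m hq hs0 hs
    obtain ⟨j, β, h₁, h₂, h₃, h₄, h₅⟩ := ih' p _ hp hc (by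
      have := Ideal.add_mem _ hpq (Ideal.mul_mem_left _ (C c) hsm)
      convert this using 1
      ring)
    exact ⟨j, β, h₁, h₂, h₃, Or.inl h₄, h₅⟩
  -- Otherwise `δ` would make its own multiple rewritable by the syzygy criterion.
  · have hδ0 : δ.poly ≠ 0 := fun h => hrew ⟨i, δ, hi, Or.inr (Or.inl ⟨⟨a, rfl⟩, h⟩)⟩
    have hind : δ.sig.ind = σ.ind := by rw [← ha]; rfl
    have hA0 : monomial a (1 : K) * δ.poly ≠ 0 := monomial_mul_ne_zero one_ne_zero hδ0
    have hA : m.degree (monomial a (1 : K) * δ.poly) = a + m.degree δ.poly :=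
      degree_monomial_mul m one_ne_zero hδ0
    -- `a δ` cannot be reduced by an element of smaller signature
    have hirr : ∀ (p q : MvPolynomial (Fin n) K), p ≠ 0 → (∀ c ∈ q.support, c ≺[m] σ.mon) →
        p - q * T.val σ.ind ∈ T.below σ.ind → m.degree p ≠ a + m.degree δ.poly := by
      -- By induction `p` shares its leading monomial with a non-rewritable `b β` of smaller
      -- signature. Then `a δ` and `b β` are `t` times the components of the S-pair of `δ` and `β`,
      -- whose signature divides `σ`. One component is rewritable by `hR`, hence so is its multiple
      -- by `t`, which is `a δ` or `b β`.
      intro p q hp hq hpq hdeg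
      obtain ⟨j, β, h₁, h₂, h₃, h₄, h₅⟩ := ih' p q hp hq hpq
      obtain ⟨t, ht₁, ht₂⟩ := exists_common_cofactor m
        (f := δ.poly) (g := β.poly) (d := m.degree p) (hdeg ▸ le_add_self) h₃
      rw [hdeg, add_tsub_cancel_right] at ht₁
      rw [ht₂] at h₄ h₅
      rw [← ha, ht₁, ← Signature.mul_mul, ← Signature.mul_mul, sigLt_mul_iff] at h₄
      rw [ht₁] at hrew
      have hle := sigLt_mul_self (T := T) (m := m) (a := t)
        (Signature.mul (cofactor m δ.poly β.poly) δ.sig)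
      rw [Signature.mul_mul, ← ht₁, ha] at hle
      rcases hR i j δ β hi h₁ hδ0 h₂ h₄ hle with h | h
      · exact hrew (h.mul t)
      · exact h₅ (h.mul t)
    have hq0 : monomial a (1 : K) * δ.quo ≠ 0 := monomial_mul_ne_zero one_ne_zero hδ.quo_ne_zero
    obtain ⟨c, hc⟩ := exists_cancel m hq hq0 (by
      rw [degree_monomial_mul m one_ne_zero hδ.quo_ne_zero, hδ.degree_quo, ← ha]
      rfl)
    have hmem : (p - C c * (monomial a 1 * δ.poly)) -
        (q - C c * (monomial a 1 * δ.quo)) * T.val σ.ind ∈ T.below σ.ind := by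
      have h := hδ.sub_mem
      rw [hind] at h
      have := Ideal.sub_mem _ hpq (Ideal.mul_mem_left _ (C c * monomial a 1) h)
      convert this using 1
      ring
    -- the case that `p` has the leading monomial of `a δ`
    have hcase : m.degree p = a + m.degree δ.poly →
        ∃ j β, T.G[j]? = some β ∧ β.poly ≠ 0 ∧ m.degree β.poly ≤ m.degree p ∧
      (T.SigLt m (Signature.mul (m.degree p - m.degree β.poly) β.sig) σ ∨
        Signature.mul (m.degree p - m.degree β.poly) β.sig = σ) ∧
      ¬ T.Rewritable m j β (m.degree p - m.degree β.poly) := by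
      intro h
      refine ⟨i, δ, hi, hδ0, ?_, ?_, ?_⟩
      · rw [h]
        exact le_add_self
      · right
        rw [h, add_tsub_cancel_right, ha]
      · rwa [h, add_tsub_cancel_right]
    by_cases hc0 : c = 0
    · simp only [hc0, C_0, zero_mul, sub_zero] at hmem hc
      obtain ⟨j, β, h₁, h₂, h₃, h₄, h₅⟩ := ih' p q hp hc hmem
      exact ⟨j, β, h₁, h₂, h₃, Or.inl h₄, h₅⟩
    have hcA : m.degree (C c * (monomial a 1 * δ.poly)) = a + m.degree δ.poly := by
      rw [← hA]
      simpa using degree_monomial_mul m (a := 0) hc0 hA0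
    set p' := p - C c * (monomial a 1 * δ.poly) with hp'
    have hpp : p = C c * (monomial a 1 * δ.poly) + p' := by rw [hp']; ring
    by_cases hp'0 : p' = 0
    · apply hcase
      rw [hpp, hp'0, add_zero, hcA]
    have hne := hirr p' _ hp'0 hc hmem
    -- The two summands of `p` have different leading monomials, so the larger one is that of `p`.
    rcases lt_or_gt_of_ne (fun h => hne (m.toSyn.injective h)) with h | h
    · apply hcase
      rw [hpp, m.degree_add_of_lt (by rwa [hcA]), hcA]
    · have hdeg : m.degree p = m.degree p' := by
        rw [hpp, m.degree_add_eq_right_of_lt (by rwa [hcA])]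
      obtain ⟨j, β, h₁, h₂, h₃, h₄, h₅⟩ := ih' p' _ hp'0 hc hmem
      rw [hdeg]
      exact ⟨j, β, h₁, h₂, h₃, Or.inl h₄, h₅⟩

end Tree

/-! ### S-pairs and reductions -/

/-- The difference of two polynomials with the same leading term has a smaller degree. -/
theorem degree_sub_lt (m : MonomialOrder (Fin n)) {f g : MvPolynomial (Fin n) K}
    (hd : m.degree f = m.degree g) (hc : m.leadingCoeff f = m.leadingCoeff g) (h : f - g ≠ 0) :
    m.degree (f - g) ≺[m] m.degree f := by
  refine lt_of_le_of_ne ?_ fun e => ?_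
  · have := m.degree_sub_le (f := f) (g := g)
    rwa [← hd, sup_idem] at this
  · have h₁ := m.degree_mem_support h
    rw [m.toSyn.injective e, mem_support_iff, coeff_sub] at h₁
    apply h₁
    have h₂ : g.coeff (m.degree f) = m.leadingCoeff g := by rw [hd]; rfl
    rw [h₂, ← hc]
    exact sub_self _

theorem leadingCoeff_monomial_mul (m : MonomialOrder (Fin n)) {q : MvPolynomial (Fin n) K}
    {a : Fin n →₀ ℕ} {c : K} : m.leadingCoeff (monomial a c * q) = c * m.leadingCoeff q := by
  by_cases hc : c = 0
  · simp [hc]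
  by_cases hq : q = 0
  · simp [hq]
  · rw [MonomialOrder.leadingCoeff, degree_monomial_mul m hc hq, coeff_monomial_mul]
    rfl

theorem cofactor_add_degree (m : MonomialOrder (Fin n)) (f g : MvPolynomial (Fin n) K) :
    cofactor m f g + m.degree f = m.degree f ⊔ m.degree g :=
  tsub_add_cancel_of_le le_sup_left

theorem degree_cofactorTerm_mul_sub_lt (m : MonomialOrder (Fin n)) {f g : MvPolynomial (Fin n) K}
    (hf : f ≠ 0) (hg : g ≠ 0) (h : cofactorTerm m f g * f - cofactorTerm m g f * g ≠ 0) :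
    m.degree (cofactorTerm m f g * f - cofactorTerm m g f * g) ≺[m] m.degree f ⊔ m.degree g := by
  have hf' : (m.leadingCoeff f) ≠ 0 := m.leadingCoeff_ne_zero_iff.2 hf
  have hg' : (m.leadingCoeff g) ≠ 0 := m.leadingCoeff_ne_zero_iff.2 hg
  have h₁ : m.degree (cofactorTerm m f g * f) = m.degree f ⊔ m.degree g := by
    rw [cofactorTerm, degree_monomial_mul m (inv_ne_zero hf') hf, cofactor_add_degree]
  have h₂ : m.degree (cofactorTerm m g f * g) = m.degree f ⊔ m.degree g := by
    rw [cofactorTerm, degree_monomial_mul m (inv_ne_zero hg') hg, cofactor_add_degree, sup_comm]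
  rw [← h₁]
  refine degree_sub_lt m (h₁.trans h₂.symm) ?_ h
  rw [cofactorTerm, cofactorTerm, leadingCoeff_monomial_mul, leadingCoeff_monomial_mul,
    inv_mul_cancel₀ hf', inv_mul_cancel₀ hg']

namespace Tree

variable {T T' : Tree n K} {m : MonomialOrder (Fin n)} {α β γ γ' : SigPoly n K}

theorem IsSig.mul (h : T.IsSig m α) (a : Fin n →₀ ℕ) {c : K} (hc : c ≠ 0) :
    T.IsSig m ⟨monomial a c * α.poly, Signature.mul a α.sig, monomial a c * α.quo⟩ where
  mem := h.mem
  quo_ne_zero := monomial_mul_ne_zero hc h.quo_ne_zero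
  degree_quo := by
    rw [degree_monomial_mul m hc h.quo_ne_zero, h.degree_quo]
    rfl
  sub_mem := by
    have := Ideal.mul_mem_left _ (monomial a c) h.sub_mem
    rw [mul_sub, ← mul_assoc] at this
    exact this

/-- Subtracting an element of smaller signature keeps the signature. -/
theorem IsSig.sub (hT : T.WellFormed) (hγ : T.IsSig m γ) (hβ : T.IsSig m β) {b : Fin n →₀ ℕ}
    {c : K} (hlt : T.SigLt m (Signature.mul b β.sig) γ.sig) (hs : γ'.sig = γ.sig)
    (hp : γ'.poly = γ.poly - monomial b c * β.poly)
    (hq : β.sig.ind = γ.sig.ind → γ'.quo = γ.quo - monomial b c * β.quo)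
    (hq' : β.sig.ind ≠ γ.sig.ind → γ'.quo = γ.quo) : T.IsSig m γ' := by
  by_cases e : β.sig.ind = γ.sig.ind
  · have hlt' : b + β.sig.mon ≺[m] γ.sig.mon := by
      rcases hlt with h | h
      · exact absurd e h.2
      · exact h.2
    by_cases hc : c = 0
    · have hp₁ : γ'.poly = γ.poly := by rw [hp, hc]; simp
      have hq₁ : γ'.quo = γ.quo := by rw [hq e, hc]; simp
      exact ⟨hs ▸ hγ.mem, hq₁ ▸ hγ.quo_ne_zero, by rw [hq₁, hs, hγ.degree_quo],
        by rw [hp₁, hq₁, hs]; exact hγ.sub_mem⟩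
    have hdeg : m.degree (γ.quo - monomial b c * β.quo) = m.degree γ.quo := by
      apply m.degree_sub_of_lt
      rwa [degree_monomial_mul m hc hβ.quo_ne_zero, hβ.degree_quo, hγ.degree_quo]
    refine ⟨hs ▸ hγ.mem, ?_, ?_, ?_⟩
    · rw [hq e]
      intro h
      rw [sub_eq_zero] at h
      rw [← hγ.degree_quo, h, degree_monomial_mul m hc hβ.quo_ne_zero, hβ.degree_quo] at hlt'
      exact lt_irrefl _ hlt'
    · rw [hq e, hdeg, hγ.degree_quo, hs]
    · have h := hβ.sub_mem
      rw [e] at h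
      rw [hp, hq e, hs]
      have := Ideal.sub_mem _ hγ.sub_mem (Ideal.mul_mem_left _ (monomial b c) h)
      convert this using 1
      ring
  · have hlt' : T.Lt β.sig.ind γ.sig.ind := by
      rcases hlt with h | h
      · exact h
      · exact absurd h.1 e
    refine ⟨hs ▸ hγ.mem, hq' e ▸ hγ.quo_ne_zero, by rw [hq' e, hγ.degree_quo, hs], ?_⟩
    rw [hp, hq' e, hs, sub_right_comm]
    exact Ideal.sub_mem _ hγ.sub_mem
      (Ideal.mul_mem_left _ _ (pathIdeal_le_below hT hlt' hβ.mem_pathIdeal))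

/-- Regularity makes the signatures of the two components differ, so the smaller is subtracted from
the larger. If the indices differ, `α` has the larger one, which agrees with the quotient being a
multiple of `α.quo` alone. -/
theorem sPairOrdered_isSig (hT : T.WellFormed) (hα : T.IsSig m α) (hβ : T.IsSig m β)
    (hr : T.Regular m α β) (h : ¬ T.SigLt m α.sig β.sig) : T.IsSig m (T.sPairOrdered m α β) := by
  obtain ⟨hα0, hβ0, hle, hne⟩ := hr
  have hα' : (m.leadingCoeff α.poly)⁻¹ ≠ 0 := inv_ne_zero (m.leadingCoeff_ne_zero_iff.2 hα0)
  have hβ' : (m.leadingCoeff β.poly)⁻¹ ≠ 0 := inv_ne_zero (m.leadingCoeff_ne_zero_iff.2 hβ0)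
  have key : T.Le β.sig.ind α.sig.ind := by
    rcases hle with hle | hle
    · by_cases e : α.sig.ind = β.sig.ind
      · rw [e]
        exact Le.refl _
      · exact absurd (Or.inl ⟨hle, e⟩) h
    · exact hle
  by_cases hlt : T.SigLt m (Signature.mul (cofactor m α.poly β.poly) α.sig)
        (Signature.mul (cofactor m β.poly α.poly) β.sig)
  · have e : α.sig.ind = β.sig.ind := hlt.ind_le.antisymm hT key
    -- Here the second component dominates although `α` comes first, which requires equal indices.
    -- The S-pair is read as `(-b β) - (-a α)`, hence the negated coefficients.
    refine IsSig.sub hT (hβ.mul (cofactor m β.poly α.poly) (neg_ne_zero.2 hβ')) hα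
      (c := -(m.leadingCoeff α.poly)⁻¹) hlt ?_ ?_ ?_ ?_
    · simp only [sPairOrdered, if_pos hlt]
    · simp only [sPairOrdered, cofactorTerm, map_neg]
      ring
    · intro _
      simp only [sPairOrdered, cofactorTerm, map_neg, if_pos e]
      ring
    · exact fun e' => absurd e e'
  · have hlt' : T.SigLt m (Signature.mul (cofactor m β.poly α.poly) β.sig)
        (Signature.mul (cofactor m α.poly β.poly) α.sig) :=
      ((sigLt_trichotomy (s := Signature.mul _ α.sig) (t := Signature.mul _ β.sig)
        hle).resolve_left hlt).resolve_left hne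
    refine IsSig.sub hT (hα.mul (cofactor m α.poly β.poly) hα') hβ
      (c := (m.leadingCoeff β.poly)⁻¹) hlt' ?_ ?_ ?_ ?_
    · simp only [sPairOrdered, if_neg hlt]
    · simp only [sPairOrdered, cofactorTerm]
    · intro e
      simp only [sPairOrdered, cofactorTerm, if_pos (show α.sig.ind = β.sig.ind from e.symm)]
    · intro e
      simp only [sPairOrdered, cofactorTerm,
        if_neg (show ¬ α.sig.ind = β.sig.ind from fun h => e h.symm)]

theorem Regular.symm (h : T.Regular m α β) : T.Regular m β α :=
  ⟨h.2.1, h.1, h.2.2.1.symm, h.2.2.2.symm⟩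

theorem sPair_isSig (hT : T.WellFormed) (hα : T.IsSig m α) (hβ : T.IsSig m β)
    (hr : T.Regular m α β) : T.IsSig m (T.sPair m α β) := by
  rw [sPair]
  split_ifs with h
  · exact sPairOrdered_isSig hT hβ hα hr.symm (h.asymm hT)
  · exact sPairOrdered_isSig hT hα hβ hr h

theorem sPair_sig_left (hT : T.WellFormed)
    (h : T.SigLt m (Signature.mul (cofactor m β.poly α.poly) β.sig)
      (Signature.mul (cofactor m α.poly β.poly) α.sig)) :
    (T.sPair m α β).sig = Signature.mul (cofactor m α.poly β.poly) α.sig := by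
  rw [sPair]
  split_ifs
  · simp only [sPairOrdered, if_pos h]
  · simp only [sPairOrdered, if_neg (h.asymm hT)]

theorem sPair_sig_right (hT : T.WellFormed)
    (h : T.SigLt m (Signature.mul (cofactor m α.poly β.poly) α.sig)
      (Signature.mul (cofactor m β.poly α.poly) β.sig)) :
    (T.sPair m α β).sig = Signature.mul (cofactor m β.poly α.poly) β.sig := by
  rw [sPair]
  split_ifs
  · simp only [sPairOrdered, if_neg (h.asymm hT)]
  · simp only [sPairOrdered, if_pos h]

theorem degree_sPair_lt (hα : α.poly ≠ 0) (hβ : β.poly ≠ 0) (h : (T.sPair m α β).poly ≠ 0) :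
    m.degree (T.sPair m α β).poly ≺[m] m.degree α.poly ⊔ m.degree β.poly := by
  rw [sPair] at h ⊢
  split_ifs at h ⊢ with hlt
  · rw [sup_comm]
    exact degree_cofactorTerm_mul_sub_lt m hβ hα h
  · exact degree_cofactorTerm_mul_sub_lt m hα hβ h

theorem ReduceStep.isSig (hT : T.WellFormed) (hG : ∀ α ∈ T.G, T.IsSig m α) (hγ : T.IsSig m γ)
    (h : T.ReduceStep m γ γ') : T.IsSig m γ' := by
  obtain ⟨β, hβ, _, _, _, hlt, hs, hp, hq⟩ := h
  refine IsSig.sub hT hγ (hG β hβ) hlt hs hp ?_ ?_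
  · intro e
    rw [hq, if_pos e]
  · intro e
    rw [hq, if_neg e]

theorem ReduceStep.sig_eq (h : T.ReduceStep m γ γ') : γ'.sig = γ.sig := by
  obtain ⟨β, hβ, _, _, _, hlt, hs, hp, hq⟩ := h
  exact hs

theorem ReduceStep.degree_lt (h : T.ReduceStep m γ γ') (h0 : γ'.poly ≠ 0) :
    m.degree γ'.poly ≺[m] m.degree γ.poly := by
  obtain ⟨β, _, hγ0, hβ0, hle, _, _, hp, _⟩ := h
  have hγ' := m.leadingCoeff_ne_zero_iff.2 hγ0
  have hβ' := m.leadingCoeff_ne_zero_iff.2 hβ0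
  rw [hp] at h0 ⊢
  refine degree_sub_lt m ?_ ?_ h0
  · rw [degree_monomial_mul m (div_ne_zero hγ' hβ') hβ0, tsub_add_cancel_of_le hle]
  · rw [leadingCoeff_monomial_mul, div_mul_cancel₀ _ hβ']

theorem ReduceStep.ne_zero (h : T.ReduceStep m γ γ') : γ.poly ≠ 0 := by
  obtain ⟨β, _, hγ0, _⟩ := h
  exact hγ0

theorem not_sigLt_of_irreducible (h : ∀ γ', ¬ T.ReduceStep m γ γ') (hγ : γ.poly ≠ 0)
    (hβ : β ∈ T.G) (hβ0 : β.poly ≠ 0) (hle : m.degree β.poly ≤ m.degree γ.poly) :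
    ¬ T.SigLt m (Signature.mul (m.degree γ.poly - m.degree β.poly) β.sig) γ.sig := by
  classical
  intro hlt
  let b : MvPolynomial (Fin n) K := monomial (m.degree γ.poly - m.degree β.poly)
    (m.leadingCoeff γ.poly / m.leadingCoeff β.poly)
  exact h ⟨γ.poly - b * β.poly, γ.sig,
    if β.sig.ind = γ.sig.ind then γ.quo - b * β.quo else γ.quo⟩
    ⟨β, hβ, hγ, hβ0, hle, hlt, rfl, rfl, rfl⟩

end Tree

/-! ### The invariant of the states -/

namespace Tree

/-- The state `T'` is a later state than `T`: nodes and entries of the basis have been added,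
and the order of the nodes of `T` is kept. -/
structure Extends (T T' : Tree n K) : Prop where
  nodes : T.nodes ⊆ T'.nodes
  le_iff : ∀ a ∈ T.nodes, ∀ b ∈ T.nodes, (T'.Le a b ↔ T.Le a b)
  val : ∀ a ∈ T.nodes, T'.val a = T.val a
  G : T.G <+: T'.G

/-- The invariant of the states of an sGB tree. Each regular S-pair is to be processed, or is
rewritable. -/
structure Inv (T : Tree n K) (m : MonomialOrder (Fin n)) : Prop where
  wf : T.WellFormed
  isSig : ∀ α ∈ T.G, T.IsSig m α
  unit : ∀ μ ∈ T.nodes, ∃ α ∈ T.G, α.sig = ⟨μ, 0⟩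
  pair_lt : ∀ p ∈ T.P, p.2 < p.1 ∧ p.1 < T.G.length
  regular : ∀ p ∈ T.P, ∀ α β, T.G[p.1]? = some α → T.G[p.2]? = some β → T.Regular m α β
  pairs : ∀ i j α β, j < i → T.G[i]? = some α → T.G[j]? = some β → T.Regular m α β →
    (i, j) ∈ T.P ∨ ¬ T.PassesCheck m (i, j) α β

variable {T T' : Tree n K} {m : MonomialOrder (Fin n)} {α β γ γ' : SigPoly n K}

theorem Extends.lt_iff (h : T.Extends T') {a b : ℕ} (ha : a ∈ T.nodes) (hb : b ∈ T.nodes) :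
    T'.Lt a b ↔ T.Lt a b := by
  simp only [Lt, h.le_iff a ha b hb]

theorem Extends.below_le (h : T.Extends T') {μ : ℕ} (hμ : μ ∈ T.nodes) :
    T.below μ ≤ T'.below μ := by
  refine Ideal.span_mono ?_
  rintro f ⟨κ, h₁, h₂, rfl⟩
  exact ⟨κ, h.nodes h₁, (h.lt_iff h₁ hμ).2 h₂, h.val κ h₁⟩

/-- The value at the index is unchanged and the ideal of its strict ancestors can only grow. -/
theorem Extends.isSig (h : T.Extends T') (hα : T.IsSig m α) : T'.IsSig m α where
  mem := h.nodes hα.mem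
  quo_ne_zero := hα.quo_ne_zero
  degree_quo := hα.degree_quo
  sub_mem := by
    rw [h.val _ hα.mem]
    exact h.below_le hα.mem hα.sub_mem

theorem Extends.regular_iff (h : T.Extends T') (hα : T.IsSig m α) (hβ : T.IsSig m β) :
    T'.Regular m α β ↔ T.Regular m α β := by
  simp only [Regular, h.le_iff _ hα.mem _ hβ.mem, h.le_iff _ hβ.mem _ hα.mem]

theorem Extends.getElem? (h : T.Extends T') {i : ℕ} (hi : T.G[i]? = some α) :
    T'.G[i]? = some α := by
  obtain ⟨l, hl⟩ := h.G
  rw [← hl, List.getElem?_append_left (List.getElem?_eq_some_iff.1 hi).1, hi]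

/-- The witness keeps its position in the basis, and the indices compare as before because both are
old nodes. -/
theorem Extends.rewritable (h : T.Extends T') (hG : ∀ α ∈ T.G, T.IsSig m α)
    (hα : T.IsSig m α) {i : ℕ} {a : Fin n →₀ ℕ} (hr : T.Rewritable m i α a) :
    T'.Rewritable m i α a := by
  obtain ⟨j, δ, hj, hr⟩ := hr
  refine ⟨j, δ, h.getElem? hj, ?_⟩
  rwa [h.lt_iff (hG δ (List.mem_of_getElem? hj)).mem hα.mem]

theorem Extends.not_passesCheck (h : T.Extends T') (hG : ∀ α ∈ T.G, T.IsSig m α)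
    (hα : T.IsSig m α) (hβ : T.IsSig m β) {p : ℕ × ℕ} (hr : ¬ T.PassesCheck m p α β) :
    ¬ T'.PassesCheck m p α β := by
  rintro ⟨h₁, h₂⟩
  exact hr ⟨fun h' => h₁ (h.rewritable hG hα h'), fun h' => h₂ (h.rewritable hG hβ h')⟩

/-- The invariant is kept when an entry is appended to the basis, provided that its regular
S-pairs are added and that the S-pairs that are dropped have become rewritable. -/
theorem Inv.append (hT : T.Inv m) (hE : T.Extends T') (hwf : T'.WellFormed)
    (hG : T'.G = T.G ++ [γ]) (hγ : T'.IsSig m γ)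
    (hunit : ∀ μ ∈ T'.nodes, ∃ α ∈ T'.G, α.sig = ⟨μ, 0⟩)
    (hP : ∀ p ∈ T'.P, p ∈ T.P ∨
      (p.1 = T.G.length ∧ ∃ β, T.G[p.2]? = some β ∧ T'.Regular m γ β))
    (hnew : ∀ j β, T.G[j]? = some β → T'.Regular m γ β → (T.G.length, j) ∈ T'.P)
    (hold : ∀ p ∈ T.P, ∀ α β, T.G[p.1]? = some α → T.G[p.2]? = some β →
      p ∈ T'.P ∨ ¬ T'.PassesCheck m p α β) : T'.Inv m where
  wf := hwf
  isSig := by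
    intro α hα
    rw [hG, List.mem_append, List.mem_singleton] at hα
    rcases hα with hα | rfl
    · exact hE.isSig (hT.isSig α hα)
    · exact hγ
  unit := hunit
  pair_lt := by
    intro p hp
    rw [hG, List.length_append, List.length_singleton]
    rcases hP p hp with h | ⟨h, β, hβ, _⟩
    · have := hT.pair_lt p h
      omega
    · have := (List.getElem?_eq_some_iff.1 hβ).1
      omega
  regular := by
    intro p hp α β hα hβ
    rw [hG] at hα hβ
    rcases hP p hp with h | ⟨h, β', hβ', hr⟩
    · have := hT.pair_lt p h
      rw [List.getElem?_append_left (by omega)] at hα hβ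
      exact (hE.regular_iff (hT.isSig α (List.mem_of_getElem? hα))
        (hT.isSig β (List.mem_of_getElem? hβ))).2 (hT.regular p h α β hα hβ)
    · rw [h, List.getElem?_append_right le_rfl] at hα
      rw [List.getElem?_append_left (List.getElem?_eq_some_iff.1 hβ').1, hβ'] at hβ
      simp only [tsub_self, List.getElem?_cons_zero, Option.some.injEq] at hα hβ
      rwa [← hα, ← hβ]
  pairs := by
    intro i j α β hji hα hβ hr
    have hi := (List.getElem?_eq_some_iff.1 hα).1
    rw [hG, List.length_append, List.length_singleton] at hi
    rw [hG] at hα hβ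
    rw [List.getElem?_append_left (by omega)] at hβ
    rcases Nat.lt_or_ge i T.G.length with h | h
    · rw [List.getElem?_append_left h] at hα
      have hα' := hT.isSig α (List.mem_of_getElem? hα)
      have hβ' := hT.isSig β (List.mem_of_getElem? hβ)
      rcases hT.pairs i j α β hji hα hβ ((hE.regular_iff hα' hβ').1 hr) with h' | h'
      · exact hold _ h' α β hα hβ
      · exact Or.inr (hE.not_passesCheck hT.isSig hα' hβ' h')
    · obtain rfl : i = T.G.length := by omega
      rw [List.getElem?_append_right le_rfl] at hα
      simp only [tsub_self, List.getElem?_cons_zero, Option.some.injEq] at hα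
      subst hα
      exact Or.inl (hnew j β hβ hr)

/-- One iteration of the main loop: a pair of minimal signature is discarded, or its S-pair is
reduced to a regular-irreducible `γ`, which is inserted. -/
def Round (T : Tree n K) (m : MonomialOrder (Fin n)) (ν : ℕ) (T' : Tree n K) : Prop :=
  ∃ p α β, T.MinPair m ν p α β ∧
    ((¬ T.PassesCheck m p α β ∧ T' = { T with P := T.P \ {p} }) ∨
      ∃ γ, T.IsSig m γ ∧ γ.sig = (T.sPair m α β).sig ∧
        (γ.poly ≠ 0 → m.degree γ.poly ≺[m] m.degree α.poly ⊔ m.degree β.poly) ∧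
        (∀ γ', ¬ T.ReduceStep m γ γ') ∧ T' = addReduced { T with P := T.P \ {p} } m γ)

theorem addReduced_G (T : Tree n K) (m : MonomialOrder (Fin n)) (γ : SigPoly n K) :
    (T.addReduced m γ).G = T.G ++ [γ] := by
  rw [addReduced]
  split_ifs <;> rfl

theorem addReduced_nodes (T : Tree n K) (m : MonomialOrder (Fin n)) (γ : SigPoly n K) :
    (T.addReduced m γ).nodes = T.nodes := by
  rw [addReduced]
  split_ifs <;> rfl

theorem addReduced_parent (T : Tree n K) (m : MonomialOrder (Fin n)) (γ : SigPoly n K) :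
    (T.addReduced m γ).parent = T.parent := by
  rw [addReduced]
  split_ifs <;> rfl

theorem addReduced_val (T : Tree n K) (m : MonomialOrder (Fin n)) (γ : SigPoly n K) :
    (T.addReduced m γ).val = T.val := by
  rw [addReduced]
  split_ifs <;> rfl

/-- The pairs after the insertion of `γ`. -/
theorem mem_addReduced_P {p : ℕ × ℕ} : p ∈ (T.addReduced m γ).P ↔
    p ∈ T.P ∨ (p.1 = T.G.length ∧ ∃ β, T.G[p.2]? = some β ∧ T.Regular m γ β) := by
  rw [addReduced]
  split_ifs with h
  · rfl
  · refine ⟨Or.inl, ?_⟩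
    rintro (h' | ⟨_, β, _, h'⟩)
    · exact h'
    · exact absurd h'.1 h

theorem Le.eq_of_parent (h : T'.parent = T.parent) : T'.Le = T.Le := by
  unfold Le
  rw [h]

theorem Regular.of_parent (h : T'.parent = T.parent) :
    T'.Regular m α β ↔ T.Regular m α β := by
  simp only [Regular, Le.eq_of_parent h]

theorem extends_of_eq (hn : T'.nodes = T.nodes) (hp : T'.parent = T.parent)
    (hv : T'.val = T.val) (hG : T.G <+: T'.G) : T.Extends T' where
  nodes := hn.symm.subset
  le_iff a _ b _ := by rw [Le.eq_of_parent hp]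
  val a _ := by rw [hv]
  G := hG

theorem WellFormed.of_eq (hT : T.WellFormed) (hn : T'.nodes = T.nodes)
    (hp : T'.parent = T.parent) : T'.WellFormed where
  depth := by
    rw [hp]
    exact hT.depth
  parent_mem := by
    rw [hp, hn]
    exact hT.parent_mem

theorem Inv.remove (hT : T.Inv m) {p : ℕ × ℕ} (hα : T.G[p.1]? = some α)
    (hβ : T.G[p.2]? = some β) (hc : ¬ T.PassesCheck m p α β) :
    Inv { T with P := T.P \ {p} } m where
  wf := ⟨hT.wf.depth, hT.wf.parent_mem⟩
  isSig α hα := Extends.isSig (extends_of_eq (T := T) rfl rfl rfl (List.prefix_refl _))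
    (hT.isSig α hα)
  unit := hT.unit
  pair_lt q hq := hT.pair_lt q hq.1
  regular q hq := hT.regular q hq.1
  pairs := by
    intro i j α' β' hji hα' hβ' hr
    rcases hT.pairs i j α' β' hji hα' hβ' hr with h | h
    · by_cases e : (i, j) = p
      · subst e
        right
        obtain rfl : α = α' := Option.some.inj (hα.symm.trans hα')
        obtain rfl : β = β' := Option.some.inj (hβ.symm.trans hβ')
        exact hc
      · exact Or.inl ⟨h, e⟩
    · exact Or.inr h

theorem MinPair.isSig_left (hT : T.Inv m) {ν : ℕ} {p : ℕ × ℕ} (h : T.MinPair m ν p α β) :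
    T.IsSig m α :=
  hT.isSig α (List.mem_of_getElem? h.1.2.1)

theorem MinPair.isSig_right (hT : T.Inv m) {ν : ℕ} {p : ℕ × ℕ} (h : T.MinPair m ν p α β) :
    T.IsSig m β :=
  hT.isSig β (List.mem_of_getElem? h.1.2.2.1)

theorem MinPair.regular (hT : T.Inv m) {ν : ℕ} {p : ℕ × ℕ} (h : T.MinPair m ν p α β) :
    T.Regular m α β :=
  hT.regular p h.1.1 α β h.1.2.1 h.1.2.2.1

/-- The signature of the S-pair of a regular pair. -/
theorem Regular.sPair_sig (hT : T.WellFormed) (h : T.Regular m α β) :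
    (T.SigLt m (Signature.mul (cofactor m β.poly α.poly) β.sig)
        (Signature.mul (cofactor m α.poly β.poly) α.sig) ∧
      (T.sPair m α β).sig = Signature.mul (cofactor m α.poly β.poly) α.sig) ∨
    (T.SigLt m (Signature.mul (cofactor m α.poly β.poly) α.sig)
        (Signature.mul (cofactor m β.poly α.poly) β.sig) ∧
      (T.sPair m α β).sig = Signature.mul (cofactor m β.poly α.poly) β.sig) := by
  rcases sigLt_trichotomy (m := m) (s := Signature.mul (cofactor m α.poly β.poly) α.sig)
    (t := Signature.mul (cofactor m β.poly α.poly) β.sig) h.2.2.1 with h' | h' | h'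
  · exact Or.inr ⟨h', sPair_sig_right hT h'⟩
  · exact absurd h' h.2.2.2
  · exact Or.inl ⟨h', sPair_sig_left hT h'⟩

theorem Round.nodes_eq {ν : ℕ} (h : T.Round m ν T') : T'.nodes = T.nodes := by
  obtain ⟨p, α, β, _, ⟨_, rfl⟩ | ⟨γ, _, _, _, _, rfl⟩⟩ := h
  · rfl
  · rw [addReduced_nodes]

theorem Round.parent_eq {ν : ℕ} (h : T.Round m ν T') : T'.parent = T.parent := by
  obtain ⟨p, α, β, _, ⟨_, rfl⟩ | ⟨γ, _, _, _, _, rfl⟩⟩ := h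
  · rfl
  · rw [addReduced_parent]

theorem Round.val_eq {ν : ℕ} (h : T.Round m ν T') : T'.val = T.val := by
  obtain ⟨p, α, β, _, ⟨_, rfl⟩ | ⟨γ, _, _, _, _, rfl⟩⟩ := h
  · rfl
  · rw [addReduced_val]

theorem Round.G_prefix {ν : ℕ} (h : T.Round m ν T') : T.G <+: T'.G := by
  obtain ⟨p, α, β, _, ⟨_, rfl⟩ | ⟨γ, _, _, _, _, rfl⟩⟩ := h
  · exact List.prefix_refl _
  · rw [addReduced_G]
    exact List.prefix_append _ _

theorem Round.extends {ν : ℕ} (h : T.Round m ν T') : T.Extends T' :=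
  extends_of_eq h.nodes_eq h.parent_eq h.val_eq h.G_prefix

/-- The pair that leaves `P` must acquire a rewritable component. The inserted `γ` has the signature
of the S-pair, that is, of its larger component, and it is later than both members. So the singular
criterion applies to that component with trivial multiplier. -/
theorem Round.inv {ν : ℕ} (hT : T.Inv m) (h : T.Round m ν T') : T'.Inv m := by
  have hE := h.extends
  have hwf := hT.wf.of_eq h.nodes_eq h.parent_eq
  have hunit : ∀ μ ∈ T'.nodes, ∃ α ∈ T'.G, α.sig = ⟨μ, 0⟩ := by
    intro μ hμ
    rw [h.nodes_eq] at hμ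
    obtain ⟨ε, hε, hε'⟩ := hT.unit μ hμ
    exact ⟨ε, h.G_prefix.subset hε, hε'⟩
  have hpar := h.parent_eq
  obtain ⟨p, α, β, hp, ⟨hc, rfl⟩ | ⟨γ, hγ, hs, _, _, rfl⟩⟩ := h
  · exact hT.remove hp.1.2.1 hp.1.2.2.1 hc
  · refine hT.append hE hwf (addReduced_G _ _ _) (hE.isSig hγ) hunit ?_ ?_ ?_
    · intro q hq
      rcases mem_addReduced_P.1 hq with h' | ⟨h', β', hβ', hr⟩
      · exact Or.inl h'.1
      · exact Or.inr ⟨h', β', hβ', (Regular.of_parent (addReduced_parent _ _ _)).2 hr⟩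
    · intro j β' hβ' hr
      exact mem_addReduced_P.2 (Or.inr ⟨rfl, β', hβ',
        (Regular.of_parent (addReduced_parent _ _ _)).1 hr⟩)
    · intro q hq α' β' hα' hβ'
      by_cases e : q = p
      · subst e
        right
        obtain rfl : α = α' := Option.some.inj (hp.1.2.1.symm.trans hα')
        obtain rfl : β = β' := Option.some.inj (hp.1.2.2.1.symm.trans hβ')
        have hlast : (addReduced { T with P := T.P \ {q} } m γ).G[T.G.length]? = some γ := by
          rw [addReduced_G]
          simp
        have hlt := hT.pair_lt q hq
        rintro ⟨h₁, h₂⟩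
        rcases (hp.regular hT).sPair_sig hT.wf with ⟨_, h'⟩ | ⟨_, h'⟩
        · exact h₁ ⟨T.G.length, γ, hlast, Or.inl ⟨⟨0, by simp [Signature.mul, hs, h']⟩, hlt.2⟩⟩
        · exact h₂ ⟨T.G.length, γ, hlast, Or.inl ⟨⟨0, by simp [Signature.mul, hs, h']⟩,
            hlt.1.trans hlt.2⟩⟩
      · exact Or.inl (mem_addReduced_P.2 (Or.inl ⟨hq, e⟩))

/-! ### Insertion of nodes -/

theorem newLabel_notMem (T : Tree n K) : T.newLabel ∉ T.nodes := by
  intro h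
  have : id T.newLabel ≤ T.nodes.sup id := Finset.le_sup h
  exact absurd this (Nat.not_succ_le_self _)

theorem WellFormed.insertNode (hT : T.WellFormed) (f : MvPolynomial (Fin n) K) {pos : Position}
    (hpos : T.ValidPosition pos) : (T.insertNode m f pos).WellFormed := by
  obtain ⟨d, hd⟩ := hT.depth
  have hν := T.newLabel_notMem
  have hmem : ∀ a b, T.parent b = some a → a ≠ T.newLabel ∧ b ≠ T.newLabel := fun a b h =>
    ⟨fun e => hν (e ▸ (hT.parent_mem a b h).1), fun e => hν (e ▸ (hT.parent_mem a b h).2)⟩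
  constructor
  · simp only [Tree.insertNode, addWithPairs]
    rcases pos with _ | μ | μ
    · refine ⟨d, fun a b h => ?_⟩
      simp only [newParent, Function.update_apply] at h
      split_ifs at h
      exact hd a b h
    · refine ⟨Function.update d T.newLabel (d μ + 1), fun a b h => ?_⟩
      have hμ : μ ≠ T.newLabel := fun e => hν (e ▸ hpos)
      simp only [newParent, Function.update_apply] at h
      split_ifs at h with hb
      · obtain rfl := Option.some.inj h
        simp [hb, hμ]
      · have := hd a b h
        simpa [(hmem a b h).1, (hmem a b h).2] using this
    -- Doubling the depths leaves room for the new node strictly between the parent of `μ`, if any,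
    -- and `μ`.
    · refine ⟨Function.update (fun x => 2 * d x + 1) T.newLabel (2 * d μ), fun a b h => ?_⟩
      have hμ : μ ≠ T.newLabel := fun e => hν (e ▸ hpos)
      simp only [newParent, Function.update_apply] at h
      split_ifs at h with hb hb'
      · obtain rfl := Option.some.inj h
        simp [hb, hμ]
      · have := hd a μ h
        simp only [hb', Function.update_self, Function.update_of_ne (hmem a μ h).1]
        omega
      · have := hd a b h
        simp only [Function.update_of_ne (hmem a b h).1, Function.update_of_ne (hmem a b h).2]
        omega
  · simp only [Tree.insertNode, addWithPairs, Finset.mem_insert]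
    intro a b h
    rcases pos with _ | μ | μ
    · simp only [newParent, Function.update_apply] at h
      split_ifs at h
      have := hT.parent_mem a b h
      exact ⟨Or.inr this.1, Or.inr this.2⟩
    · simp only [newParent, Function.update_apply] at h
      split_ifs at h with hb
      · obtain rfl := Option.some.inj h
        exact ⟨Or.inr hpos, Or.inl hb⟩
      · have := hT.parent_mem a b h
        exact ⟨Or.inr this.1, Or.inr this.2⟩
    · simp only [newParent, Function.update_apply] at h
      split_ifs at h with hb hb'
      · obtain rfl := Option.some.inj h
        exact ⟨Or.inl rfl, Or.inr (hb ▸ hpos)⟩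
      · exact ⟨Or.inr (hT.parent_mem a μ h).1, Or.inl hb'⟩
      · have := hT.parent_mem a b h
        exact ⟨Or.inr this.1, Or.inr this.2⟩

theorem Le.insertNode (hT : T.WellFormed) (f : MvPolynomial (Fin n) K) {pos : Position}
    {a b : ℕ} (h : T.Le a b) : (T.insertNode m f pos).Le a b := by
  have hν := T.newLabel_notMem
  induction h with
  | refl => exact Le.refl _
  | @tail b c _ h ih =>
    have hc : c ≠ T.newLabel := fun e => hν (e ▸ (hT.parent_mem b c h).2)
    refine ih.trans ?_
    rcases pos with _ | μ | μ
    · apply Le.of_parent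
      simpa [Tree.insertNode, addWithPairs, newParent, hc] using h
    · apply Le.of_parent
      simpa [Tree.insertNode, addWithPairs, newParent, hc] using h
    -- The only edge that is destroyed is the one from the parent of `μ`; the path through the new
    -- node replaces it.
    · by_cases e : c = μ
      · subst e
        refine Le.trans (b := T.newLabel) (Le.of_parent ?_) (Le.of_parent ?_)
        · simpa [Tree.insertNode, addWithPairs, newParent, Ne.symm hc] using h
        · simp [Tree.insertNode, addWithPairs, newParent]
      · apply Le.of_parent
        simpa [Tree.insertNode, addWithPairs, newParent, hc, e] using h

theorem Le.of_insertNode (hT : T.WellFormed) {f : MvPolynomial (Fin n) K} {pos : Position}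
    (hpos : T.ValidPosition pos) {a b : ℕ} (ha : a ∈ T.nodes) (hb : b ∈ T.nodes)
    (h : (T.insertNode m f pos).Le a b) : T.Le a b := by
  have hν := T.newLabel_notMem
  have hmem : ∀ a b, T.parent b = some a → a ≠ T.newLabel ∧ b ≠ T.newLabel := fun a b h =>
    ⟨fun e => hν (e ▸ (hT.parent_mem a b h).1), fun e => hν (e ▸ (hT.parent_mem a b h).2)⟩
  -- `g` is a monotone retraction onto the old tree: a new leaf is collapsed into its parent, and a
  -- node inserted above `μ` into `μ`.
  obtain ⟨g, hg, hstep⟩ : ∃ g : ℕ → ℕ, (∀ x, x ≠ T.newLabel → g x = x) ∧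
      ∀ x y, (T.insertNode m f pos).parent y = some x → T.Le (g x) (g y) := by
    simp only [Tree.insertNode, addWithPairs]
    rcases pos with _ | μ | μ
    · refine ⟨id, fun _ _ => rfl, fun x y h => ?_⟩
      simp only [newParent, Function.update_apply] at h
      split_ifs at h
      exact Le.of_parent h
    · have hμ : μ ≠ T.newLabel := fun e => hν (e ▸ hpos)
      refine ⟨Function.update id T.newLabel μ, fun x hx => by simp [hx], fun x y h => ?_⟩
      simp only [newParent, Function.update_apply] at h
      split_ifs at h with hy
      · obtain rfl := Option.some.inj h
        simp only [hy, Function.update_self, Function.update_of_ne hμ]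
        exact Le.refl _
      · simp only [Function.update_of_ne (hmem x y h).1, Function.update_of_ne (hmem x y h).2]
        exact Le.of_parent h
    · have hμ : μ ≠ T.newLabel := fun e => hν (e ▸ hpos)
      refine ⟨Function.update id T.newLabel μ, fun x hx => by simp [hx], fun x y h => ?_⟩
      simp only [newParent, Function.update_apply] at h
      split_ifs at h with hy hy'
      · obtain rfl := Option.some.inj h
        simp only [hy, Function.update_self, Function.update_of_ne hμ]
        exact Le.refl _
      · simp only [hy', Function.update_self, Function.update_of_ne (hmem x μ h).1]
        exact Le.of_parent h
      · simp only [Function.update_of_ne (hmem x y h).1, Function.update_of_ne (hmem x y h).2]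
        exact Le.of_parent h
  have key : T.Le (g a) (g b) := by
    clear ha hb
    induction h with
    | refl => exact Le.refl _
    | tail _ h ih => exact ih.trans (hstep _ _ h)
  rwa [hg a (ne_of_mem_of_not_mem ha hν), hg b (ne_of_mem_of_not_mem hb hν)] at key

theorem Inv.insertNode (hT : T.Inv m) (f : MvPolynomial (Fin n) K) {pos : Position}
    (hpos : T.ValidPosition pos) : (T.insertNode m f pos).Inv m := by
  have hν := T.newLabel_notMem
  have hE : T.Extends (T.insertNode m f pos) :=
    { nodes := Finset.subset_insert _ _
      le_iff := fun a ha b hb => ⟨Le.of_insertNode hT.wf hpos ha hb, Le.insertNode hT.wf f⟩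
      val := fun a ha => Function.update_of_ne (ne_of_mem_of_not_mem ha hν) _ _
      G := List.prefix_append _ _ }
  refine hT.append (γ := ⟨f, ⟨T.newLabel, 0⟩, 1⟩) hE (hT.wf.insertNode f hpos) rfl ?_ ?_ ?_ ?_ ?_
  · refine ⟨Finset.mem_insert_self _ _, one_ne_zero, ?_, ?_⟩
    · rw [← C_1, m.degree_C]
    · simp [Tree.insertNode, addWithPairs]
  · intro μ hμ
    rcases Finset.mem_insert.1 hμ with rfl | hμ
    · exact ⟨_, List.mem_append_right _ (List.mem_singleton_self _), rfl⟩
    · obtain ⟨α, hα, hα'⟩ := hT.unit μ hμ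
      exact ⟨α, List.mem_append_left _ hα, hα'⟩
  · exact fun p hp => hp
  · exact fun j β hj hr => Or.inr ⟨rfl, β, hj, hr⟩
  · exact fun p hp α β _ _ => Or.inl (Or.inl hp)

theorem Inv.empty (m : MonomialOrder (Fin n)) : (Tree.empty n K).Inv m where
  wf := ⟨⟨fun _ => 0, by simp [Tree.empty]⟩, by simp [Tree.empty]⟩
  isSig := by simp [Tree.empty]
  unit := by simp [Tree.empty]
  pair_lt := by simp [Tree.empty]
  regular := by simp [Tree.empty]
  pairs := by simp [Tree.empty]

end Tree

/-! ### The invariant of the configurations -/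

/-- `γ` is an intermediate result of the regular reduction of the S-pair that was selected in the
state `T₀`, and `T` is the state after the removal of this pair. -/
def Tree.Selected (T₀ : Tree n K) (m : MonomialOrder (Fin n)) (ν : ℕ) (T : Tree n K)
    (γ : SigPoly n K) : Prop :=
  ∃ p α β, T₀.MinPair m ν p α β ∧ T = { T₀ with P := T₀.P \ {p} } ∧
    T₀.IsSig m γ ∧ γ.sig = (T₀.sPair m α β).sig ∧
    (γ.poly ≠ 0 → m.degree γ.poly ≺[m] m.degree α.poly ⊔ m.degree β.poly)

/-- The invariant of the configurations: the state satisfies the invariant, possibly up to the pair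
that is being processed. -/
def Config.Inv {ρ : Type*} (m : MonomialOrder (Fin n)) (ν : ℕ) : Config n K ρ → Prop
  | .loop T => T.Inv m
  | .reducing T γ => ∃ T₀ : Tree n K, T₀.Inv m ∧ T₀.Selected m ν T γ
  | .returned T _ => T.Inv m

section steps

variable {ρ : Type*} {m : MonomialOrder (Fin n)} {ν : ℕ} {T T₀ T' : Tree n K}
  {γ γ' : SigPoly n K}

theorem Tree.selected_sPair (hT : T.Inv m) {p : ℕ × ℕ} {α β : SigPoly n K}
    (hp : T.MinPair m ν p α β) :
    T.Selected m ν { T with P := T.P \ {p} } (T.sPair m α β) :=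
  ⟨p, α, β, hp, rfl, Tree.sPair_isSig hT.wf (hp.isSig_left hT) (hp.isSig_right hT)
    (hp.regular hT), rfl, Tree.degree_sPair_lt (hp.regular hT).1 (hp.regular hT).2.1⟩

theorem Tree.Selected.reduce (hT : T₀.Inv m) (h : T₀.Selected m ν T γ)
    (hr : T.ReduceStep m γ γ') : T₀.Selected m ν T γ' := by
  obtain ⟨p, α, β, hp, rfl, h₁, h₂, h₃⟩ := h
  have hr' : T₀.ReduceStep m γ γ' := hr
  exact ⟨p, α, β, hp, rfl, hr'.isSig hT.wf hT.isSig h₁, hr'.sig_eq.trans h₂,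
    fun h0 => (hr'.degree_lt h0).trans (h₃ hr'.ne_zero)⟩

theorem Tree.Selected.round (h : T₀.Selected m ν T γ) (hr : ∀ γ', ¬ T.ReduceStep m γ γ') :
    T₀.Round m ν (T.addReduced m γ) := by
  obtain ⟨p, α, β, hp, rfl, h₁, h₂, h₃⟩ := h
  exact ⟨p, α, β, hp, Or.inr ⟨γ, h₁, h₂, h₃, hr, rfl⟩⟩

theorem LoopStep.inv {guard : Tree n K → Prop} {c c' : Config n K ρ}
    (h : LoopStep m ν guard c c') (hc : c.Inv m ν) : c'.Inv m ν := by
  cases h with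
  | discard T p α β hg hp hc' =>
    have hT : T.Inv m := hc
    exact hT.remove hp.1.2.1 hp.1.2.2.1 hc'
  | select T p α β hg hp hc' => exact ⟨T, hc, Tree.selected_sPair hc hp⟩
  | reduce T γ γ' hr =>
    obtain ⟨T₀, hT₀, h⟩ := hc
    exact ⟨T₀, hT₀, h.reduce hT₀ hr⟩
  | insert T γ hr =>
    obtain ⟨T₀, hT₀, h⟩ := hc
    exact (h.round hr).inv hT₀

theorem BasisStep.inv {c c' : Config n K (Set (MvPolynomial (Fin n) K))}
    (h : BasisStep m ν c c') (hc : c.Inv m ν) : c'.Inv m ν := by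
  cases h with
  | body _ _ h => exact h.inv hc
  | ret T h => exact hc

/-- The recorded syzygies play no role in the invariant; the criteria refer only to entries of `G`.
-/
theorem Tree.Inv.updateS (hT : T.Inv m) (S : ℕ → Set (MvPolynomial (Fin n) K)) :
    Tree.Inv { T with S := S } m :=
  ⟨⟨hT.wf.depth, hT.wf.parent_mem⟩, fun α hα =>
    Tree.Extends.isSig (Tree.extends_of_eq (T := T) rfl rfl rfl (List.prefix_refl _))
      (hT.isSig α hα),
    hT.unit, hT.pair_lt, hT.regular, hT.pairs⟩

theorem GetSyzygyStep.inv {c c' : Config n K (MvPolynomial (Fin n) K)}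
    (h : GetSyzygyStep m ν c c') (hc : c.Inv m ν) : c'.Inv m ν := by
  cases h with
  | body _ _ h => exact h.inv hc
  | pick T f hf => exact Tree.Inv.updateS hc _
  | zero T h hS => exact hc

theorem Tree.Reachable.inv (hT : T.Reachable m) : T.Inv m := by
  induction hT with
  | empty => exact Tree.Inv.empty m
  | insertNode T f pos _ hpos ih => exact ih.insertNode f hpos
  | basis T T' ν out _ _ h ih =>
    suffices ∀ c, Relation.ReflTransGen (BasisStep m ν) (.loop T) c → c.Inv m ν from this _ h
    intro c h
    induction h with
    | refl => exact ih
    | tail _ h ih => exact h.inv ih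
  | getSyzygy T T' ν out _ _ h ih =>
    suffices ∀ c, Relation.ReflTransGen (GetSyzygyStep m ν) (.loop T) c → c.Inv m ν from this _ h
    intro c h
    induction h with
    | refl => exact ih
    | tail _ h ih => exact h.inv ih

end steps

/-! ### Partial correctness -/

namespace Tree

variable {T T' : Tree n K} {m : MonomialOrder (Fin n)} {α β γ δ : SigPoly n K} {ν : ℕ}

/-- Pairs are stored with the later position first, whereas `RewritablePairs` puts the larger
signature first, so both orders of the positions occur. The lemma serves at the end, when no pair is
left, and during the loop, below the minimal signature. -/
theorem Inv.rewritablePairs (hT : T.Inv m) {σ : Signature n} (hσ : T.Le σ.ind ν)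
    (h : ∀ p α β, T.PairBelow ν p α β →
      ¬ (T.SigLt m (T.sPair m α β).sig σ ∨ (T.sPair m α β).sig = σ)) :
    T.RewritablePairs m σ := by
  intro i j α β hi hj hα hβ hlt hle
  have hβα : T.Le β.sig.ind α.sig.ind := hlt.ind_le
  have hασ : T.Le α.sig.ind σ.ind := by
    rcases hle with hle | hle
    · exact hle.ind_le
    · rw [← hle]
      exact Le.refl _
  have hαν := hασ.trans hσ
  have hβν := hβα.trans hαν
  have hr : T.Regular m α β := ⟨hα, hβ, Or.inr hβα, fun e => SigLt.irrefl _ (e ▸ hlt)⟩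
  rcases lt_trichotomy j i with hji | rfl | hij
  · rcases hT.pairs i j α β hji hi hj hr with h' | h'
    · refine absurd ?_ (h (i, j) α β ⟨h', hi, hj, hαν, hβν⟩)
      rwa [sPair_sig_left hT.wf hlt]
    · exact (not_and_or.1 h').imp not_not.1 not_not.1
  · obtain rfl := Option.some.inj (hi.symm.trans hj)
    exact absurd hlt (SigLt.irrefl _)
  · rcases hT.pairs j i β α hij hj hi hr.symm with h' | h'
    · refine absurd ?_ (h (j, i) β α ⟨h', hj, hi, hβν, hαν⟩)
      rwa [sPair_sig_right hT.wf hlt]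
    · exact ((not_and_or.1 h').imp not_not.1 not_not.1).symm

/-- If no pair is left, the polynomials of the basis are a Gröbner basis. -/
theorem Inv.isGroebnerBasis (hT : T.Inv m) (hν : ν ∈ T.nodes) (h : ¬ T.HasPair ν) :
    IsGroebnerBasis m {f | ∃ α ∈ T.G, T.Le α.sig.ind ν ∧ α.poly = f} (T.pathIdeal ν) := by
  have hsub : {f | ∃ α ∈ T.G, T.Le α.sig.ind ν ∧ α.poly = f} ⊆
      (T.pathIdeal ν : Set (MvPolynomial (Fin n) K)) := by
    rintro f ⟨α, hα, hle, rfl⟩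
    exact pathIdeal_mono hle (hT.isSig α hα).mem_pathIdeal
  refine ⟨?_, hsub, le_antisymm (Ideal.span_mono (Set.image_mono hsub)) ?_⟩
  · refine (T.G.finite_toSet.image SigPoly.poly).subset ?_
    rintro f ⟨α, hα, _, rfl⟩
    exact ⟨α, hα, rfl⟩
  · rw [Ideal.span_le]
    rintro _ ⟨f, hf, rfl⟩
    by_cases hf0 : f = 0
    · rw [hf0, m.leadingTerm_zero]
      exact Ideal.zero_mem _
    obtain ⟨d, hd⟩ := exists_spans (m := m) hν hf
    -- Every element of `I_ν` has some signature with index `ν`, and without remaining pairs no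
    -- bound on the signature is needed.
    obtain ⟨j, β, hj, hβ0, hle, hlt, _⟩ := exists_reducer hT.wf hT.isSig hT.unit (σ := ⟨ν, d⟩) hν
      (hT.rewritablePairs (Le.refl ν) fun p α β hp _ => h ⟨p, α, β, hp⟩) hf0 hd
    have hβν : T.Le β.sig.ind ν := by
      rcases hlt with hlt | hlt
      · exact hlt.ind_le
      · have := congrArg Signature.ind hlt
        simp only [Signature.mul] at this
        rw [this]
        exact Le.refl _
    have e : m.leadingTerm f = monomial (m.degree f - m.degree β.poly)
        (m.leadingCoeff f / m.leadingCoeff β.poly) * m.leadingTerm β.poly := by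
      rw [MonomialOrder.leadingTerm, MonomialOrder.leadingTerm, monomial_mul,
        tsub_add_cancel_of_le hle, div_mul_cancel₀ _ (m.leadingCoeff_ne_zero_iff.2 hβ0)]
    rw [SetLike.mem_coe, e]
    exact Ideal.mul_mem_left _ _ (Ideal.subset_span
      ⟨β.poly, ⟨β, List.mem_of_getElem? hj, hβν, rfl⟩, rfl⟩)

theorem HasPair.exists_minPair (hT : T.WellFormed) (h : T.HasPair ν) :
    ∃ p α β, T.MinPair m ν p α β := by
  obtain ⟨p, α, β, h⟩ := h
  obtain ⟨s, ⟨p, α, β, hp, rfl⟩, hmin⟩ := (sigLt_wellFounded (m := m) hT).has_min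
    {s | ∃ p α β, T.PairBelow ν p α β ∧ (T.sPair m α β).sig = s} ⟨_, p, α, β, h, rfl⟩
  exact ⟨p, α, β, hp, fun p' α' β' h' => hmin _ ⟨p', α', β', h', rfl⟩⟩

end Tree

/-- The state of the tree in a configuration. -/
def Config.tree {ρ : Type*} : Config n K ρ → Tree n K
  | .loop T => T
  | .reducing T _ => T
  | .returned T _ => T

section steps

variable {m : MonomialOrder (Fin n)} {ν : ℕ} {T T₀ T' : Tree n K} {γ : SigPoly n K}
  {c c' : Config n K (Set (MvPolynomial (Fin n) K))}

theorem BasisStep.sameTree (h : BasisStep m ν c c') :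
    c'.tree.nodes = c.tree.nodes ∧ c'.tree.parent = c.tree.parent ∧
      c'.tree.val = c.tree.val := by
  cases h with
  | body _ _ h =>
    cases h with
    | discard => exact ⟨rfl, rfl, rfl⟩
    | select => exact ⟨rfl, rfl, rfl⟩
    | reduce => exact ⟨rfl, rfl, rfl⟩
    | insert T γ hr =>
      exact ⟨T.addReduced_nodes m γ, T.addReduced_parent m γ, T.addReduced_val m γ⟩
  | ret T h => exact ⟨rfl, rfl, rfl⟩

theorem reachable_invariant (hT : T.Inv m)
    (h : Relation.ReflTransGen (BasisStep m ν) (.loop T) c) :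
    c.Inv m ν ∧ c.tree.nodes = T.nodes ∧ c.tree.parent = T.parent ∧ c.tree.val = T.val := by
  induction h with
  | refl => exact ⟨hT, rfl, rfl, rfl⟩
  | tail _ h ih =>
    obtain ⟨h₁, h₂, h₃⟩ := h.sameTree
    exact ⟨h.inv ih.1, h₁.trans ih.2.1, h₂.trans ih.2.2.1, h₃.trans ih.2.2.2⟩

/-- A computation that cannot be continued has returned a Gröbner basis. -/
theorem isGroebnerBasis_of_terminal (hT : T.Inv m) (hν : ν ∈ T.nodes)
    (h : Relation.ReflTransGen (BasisStep m ν) (.loop T) c) (hc : ∀ c', ¬ BasisStep m ν c c') :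
    ∃ (T' : Tree n K) (out : Set (MvPolynomial (Fin n) K)),
      c = .returned T' out ∧ IsGroebnerBasis m out (T.pathIdeal ν) := by
  cases c with
  | loop T' =>
    exfalso
    have hT' : T'.Inv m := (reachable_invariant hT h).1
    by_cases hp : T'.HasPair ν
    · obtain ⟨p, α, β, hmin⟩ := hp.exists_minPair (m := m) hT'.wf
      by_cases hpass : T'.PassesCheck m p α β
      · exact hc _ (.body _ _ (.select T' p α β hp hmin hpass))
      · exact hc _ (.body _ _ (.discard T' p α β hp hmin hpass))
    · exact hc _ (.ret T' hp)
  | reducing T' γ =>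
    exfalso
    by_cases hr : ∃ γ', T'.ReduceStep m γ γ'
    · obtain ⟨γ', hr⟩ := hr
      exact hc _ (.body _ _ (.reduce T' γ γ' hr))
    · exact hc _ (.body _ _ (.insert T' γ (not_exists.1 hr)))
  | returned T' out =>
    refine ⟨T', out, rfl, ?_⟩
    -- Only the step `ret` leads to a returned configuration, so the guard failed in the state
    -- before it.
    rcases Relation.ReflTransGen.cases_tail h with h' | ⟨b, hb, hstep⟩
    · cases h'
    · obtain ⟨hinv, hn, hp, hv⟩ := reachable_invariant hT hb
      cases hstep with
      | body _ _ h' => cases h'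
      | ret _ hno =>
        have hT' : T'.Inv m := hinv
        have e : T'.pathIdeal ν = T.pathIdeal ν := by
          simp only [Config.tree] at hn hp hv
          simp only [Tree.pathIdeal, hn, hv, Tree.Le.eq_of_parent hp]
        rw [← e]
        refine hT'.isGroebnerBasis ?_ hno
        have : T'.nodes = T.nodes := hn
        rwa [this]

/-! ### Reduction of termination to the iterations of the main loop -/

/-- A regular reduction terminates. -/
theorem acc_reducing (hT₀ : T₀.Inv m)
    (hacc : ∀ T', T₀.Round m ν T' → Acc (fun c' c => BasisStep m ν c c') (.loop T'))
    (h : T₀.Selected m ν T γ) :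
    Acc (fun c' c => BasisStep m ν c c') (.reducing T γ) := by
  have hinsert : ∀ γ, T₀.Selected m ν T γ → (∀ γ', ¬ T.ReduceStep m γ γ') →
      Acc (fun c' c => BasisStep m ν c c') (.loop (T.addReduced m γ)) :=
    fun γ h hr => hacc _ (h.round hr)
  -- The zero polynomial has degree `0` by convention, so a reduction to zero need not lower the
  -- degree; this case is settled outside the induction.
  have hzero : ∀ γ, T₀.Selected m ν T γ → γ.poly = 0 →
      Acc (fun c' c => BasisStep m ν c c') (.reducing T γ) := by
    intro γ h h0
    refine Acc.intro _ fun c' hc' => ?_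
    cases hc' with
    | body _ _ hc' =>
      cases hc' with
      | reduce _ _ γ' hr => exact absurd h0 hr.ne_zero
      | insert _ _ hr => exact hinsert γ h hr
  induction hd : m.toSyn (m.degree γ.poly) using WellFoundedLT.induction generalizing γ with
  | _ d ih =>
  subst hd
  refine Acc.intro _ fun c' hc' => ?_
  cases hc' with
  | body _ _ hc' =>
    cases hc' with
    | reduce _ _ γ' hr =>
      by_cases h0 : γ'.poly = 0
      · exact hzero γ' (h.reduce hT₀ hr) h0
      · exact ih _ (hr.degree_lt h0) (h.reduce hT₀ hr) rfl
    | insert _ _ hr => exact hinsert γ h hr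

/-- Each elementary step from the head of the loop discards a pair, starts a reduction that
terminates and completes a round, or returns. A returned configuration has no successor. -/
theorem acc_loop (hT : T.Inv m) (hacc : Acc (fun T' T => T.Round m ν T') T) :
    Acc (fun c' c : Config n K (Set (MvPolynomial (Fin n) K)) => BasisStep m ν c c')
      (.loop T) := by
  induction hacc with
  | intro T _ ih =>
  have ih' : ∀ T', T.Round m ν T' → Acc (fun c' c => BasisStep m ν c c') (.loop T') :=
    fun T' h => ih T' h (h.inv hT)
  refine Acc.intro _ fun c' hc' => ?_
  cases hc' with
  | body _ _ hc' =>
    cases hc' with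
    | discard _ p α β hg hp hc => exact ih' _ ⟨p, α, β, hp, Or.inl ⟨hc, rfl⟩⟩
    | select _ p α β hg hp hc => exact acc_reducing hT ih' (Tree.selected_sPair hT hp)
  | ret _ h =>
    refine Acc.intro _ fun c' hc' => ?_
    cases hc' with
    | body _ _ hc' => cases hc'

end steps

/-! ### Termination -/

section order

variable {M : Type*} [AddCommMonoid M] [PartialOrder M] [IsOrderedCancelAddMonoid M]

/-- This is transitivity for the differences `a - c`, `b - d`, `e - f`, written without subtraction.
-/
theorem add_lt_add_trans {a b c d e f : M} (h : a + d < b + c) (h' : b + f < e + d) :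
    a + f < e + c := by
  have := add_lt_add h h'
  rw [show a + d + (b + f) = (b + d) + (a + f) by abel,
    show b + c + (e + d) = (b + d) + (e + c) by abel] at this
  exact lt_of_add_lt_add_left this

end order

/-- `α` has a smaller index than `β`, or the same index and a smaller quotient of the signature by
the leading monomial. -/
def Tree.RatioLt (T : Tree n K) (m : MonomialOrder (Fin n)) (α β : SigPoly n K) : Prop :=
  T.Lt α.sig.ind β.sig.ind ∨ (α.sig.ind = β.sig.ind ∧
    α.sig.mon + m.degree β.poly ≺[m] β.sig.mon + m.degree α.poly)

/-- `α` and `β` have the same index and the same quotient of the signature by the leading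
monomial. -/
def RatioEq (m : MonomialOrder (Fin n)) (α β : SigPoly n K) : Prop :=
  α.sig.ind = β.sig.ind ∧ α.sig.mon + m.degree β.poly = β.sig.mon + m.degree α.poly

section ratio

variable {m : MonomialOrder (Fin n)} {α β γ : SigPoly n K} {T : Tree n K}

theorem RatioEq.refl (α : SigPoly n K) : RatioEq m α α := ⟨rfl, rfl⟩

theorem RatioEq.trans (h : RatioEq m α β) (h' : RatioEq m β γ) : RatioEq m α γ := by
  refine ⟨h.1.trans h'.1, ?_⟩
  have h₁ := h.2
  have h₂ := h'.2
  ext i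
  have h₁ := DFunLike.congr_fun h₁ i
  have h₂ := DFunLike.congr_fun h₂ i
  simp only [Finsupp.add_apply] at h₁ h₂ ⊢
  omega

theorem Tree.RatioLt.trans (hT : T.WellFormed) (h : T.RatioLt m α β) (h' : T.RatioLt m β γ) :
    T.RatioLt m α γ := by
  rcases h with h | h
  · left
    rcases h' with h' | h'
    · exact h.trans_le hT h'.1
    · rwa [← h'.1]
  · rcases h' with h' | h'
    · left
      rwa [h.1]
    · refine Or.inr ⟨h.1.trans h'.1, ?_⟩
      have h₁ := h.2
      have h₂ := h'.2
      rw [map_add, map_add] at h₁ h₂ ⊢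
      exact add_lt_add_trans h₁ h₂

theorem Tree.RatioLt.irrefl (α : SigPoly n K) : ¬ T.RatioLt m α α := by
  rintro (h | h)
  · exact h.2 rfl
  · exact lt_irrefl _ h.2

/-- The comparison depends only on the ratio classes: fractions are compared by
cross-multiplication, and the common factors cancel. -/
theorem Tree.RatioLt.congr {α' β' : SigPoly n K} (h : T.RatioLt m α β) (hα : RatioEq m α' α)
    (hβ : RatioEq m β' β) : T.RatioLt m α' β' := by
  rcases h with h | h
  · left
    rwa [hα.1, hβ.1]
  · refine Or.inr ⟨hα.1.trans (h.1.trans hβ.1.symm), ?_⟩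
    have h₁ := congrArg m.toSyn hα.2
    have h₂ := congrArg m.toSyn hβ.2
    have h₃ := h.2
    simp only [map_add] at h₁ h₂ h₃ ⊢
    refine lt_of_add_lt_add_left
      (a := m.toSyn α.sig.mon + m.toSyn β.sig.mon + m.toSyn (m.degree α.poly) +
        m.toSyn (m.degree β.poly)) ?_
    calc _ = (m.toSyn α'.sig.mon + m.toSyn (m.degree α.poly)) +
          (m.toSyn β.sig.mon + m.toSyn (m.degree β'.poly)) +
          (m.toSyn α.sig.mon + m.toSyn (m.degree β.poly)) := by abel
      _ < (m.toSyn α'.sig.mon + m.toSyn (m.degree α.poly)) +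
          (m.toSyn β.sig.mon + m.toSyn (m.degree β'.poly)) +
          (m.toSyn β.sig.mon + m.toSyn (m.degree α.poly)) := by gcongr
      _ = _ := by
        rw [h₁, ← h₂]
        abel

/-- A sequence in which each element, from some point on, arises from a pair of elements of smaller
ratio, different elements arise from different pairs, and divisibility of signatures and leading
monomials implies equality of ratios, cannot be infinite. -/
theorem not_infinite_sequence (hT : T.WellFormed) (e : ℕ → SigPoly n K) (N : ℕ)
    (par : ℕ → ℕ × ℕ) (hmem : ∀ i, (e i).sig.ind ∈ T.nodes)
    (hinj : Set.InjOn par (Set.Ici N))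
    (hpar : ∀ i, N ≤ i → (e (par i).1).poly ≠ 0 ∧ (e (par i).2).poly ≠ 0)
    (hlt : ∀ i, N ≤ i → (e i).poly ≠ 0 →
      T.RatioLt m (e (par i).1) (e i) ∧ T.RatioLt m (e (par i).2) (e i))
    (hdvd : ∀ i j, N ≤ i → j < i → (e i).poly ≠ 0 → (e j).poly ≠ 0 →
      (e j).sig.ind = (e i).sig.ind → (e j).sig.mon ≤ (e i).sig.mon →
      m.degree (e j).poly ≤ m.degree (e i).poly → RatioEq m (e j) (e i)) : False := by
  -- the elements that are not divisible by an earlier one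
  let M₀ : Set ℕ := {i | (e i).poly ≠ 0 ∧ ∀ j < i, (e j).poly ≠ 0 →
    (e j).sig.ind = (e i).sig.ind → (e j).sig.mon ≤ (e i).sig.mon →
      ¬ m.degree (e j).poly ≤ m.degree (e i).poly}
  -- Dickson's lemma for the pairs of signature monomial and leading monomial, applied to each of
  -- the finitely many indices.
  have hM₀ : M₀.Finite := by
    have hμ : ∀ μ, {i ∈ M₀ | (e i).sig.ind = μ}.Finite := by
      intro μ
      by_contra hinf
      have : Infinite {i ∈ M₀ | (e i).sig.ind = μ} := Set.infinite_coe_iff.2 hinf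
      classical
      let g := Nat.orderEmbeddingOfSet {i ∈ M₀ | (e i).sig.ind = μ}
      have hg : ∀ k, g k ∈ {i ∈ M₀ | (e i).sig.ind = μ} := fun k => by
        have := Nat.orderEmbeddingOfSet_range {i ∈ M₀ | (e i).sig.ind = μ}
        exact this ▸ Set.mem_range_self k
      obtain ⟨k, l, hkl, hle⟩ := wellQuasiOrdered_le
        (fun k => ((e (g k)).sig.mon, m.degree (e (g k)).poly))
      exact (hg l).1.2 (g k) (g.strictMono hkl) (hg k).1.1 ((hg k).2.trans (hg l).2.symm)
        hle.1 hle.2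
    refine (T.nodes.finite_toSet.biUnion fun μ _ => hμ μ).subset fun i hi => ?_
    exact Set.mem_biUnion (hmem i) ⟨hi, rfl⟩
  have hM : (M₀ ∪ Set.Iio N).Finite := hM₀.union (Set.finite_Iio N)
  -- Following earlier divisors, which have the same ratio from `N` on, every nonzero element
  -- reaches the finite set. The first `N` elements are included wholesale, since nothing is known
  -- about their origin.
  have hrep : ∀ i, ∃ r, (e i).poly ≠ 0 → r ∈ M₀ ∪ Set.Iio N ∧ RatioEq m (e r) (e i) := by
    intro i
    induction i using Nat.strong_induction_on with
    | _ i ih =>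
    by_cases hi : i ∈ M₀ ∪ Set.Iio N
    · exact ⟨i, fun _ => ⟨hi, RatioEq.refl _⟩⟩
    by_cases h0 : (e i).poly = 0
    · exact ⟨i, fun h => absurd h0 h⟩
    rw [Set.mem_union, not_or, Set.mem_Iio, not_lt] at hi
    obtain ⟨j, hji, hj0, h₁, h₂, h₃⟩ : ∃ j < i, (e j).poly ≠ 0 ∧ (e j).sig.ind = (e i).sig.ind ∧
        (e j).sig.mon ≤ (e i).sig.mon ∧ m.degree (e j).poly ≤ m.degree (e i).poly := by
      by_contra hcon
      exact hi.1 ⟨h0, fun j hj h₀ h₁ h₂ h₃ => hcon ⟨j, hj, h₀, h₁, h₂, h₃⟩⟩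
    obtain ⟨r, hr⟩ := ih j hji
    exact ⟨r, fun _ => ⟨(hr hj0).1, (hr hj0).2.trans (hdvd i j hi.2 hji h0 hj0 h₁ h₂ h₃)⟩⟩
  choose rep hrep using hrep
  let R : ℕ → ℕ → Prop := fun x y => T.RatioLt m (e x) (e y)
  have : IsStrictOrder ℕ R :=
    { irrefl := fun x => Tree.RatioLt.irrefl (e x)
      trans := fun x y z => Tree.RatioLt.trans hT }
  -- Induction on the ratio over the finite set of representatives: from `N` on, the elements of one
  -- class come from distinct pairs of elements of smaller classes, whose number is finite by
  -- induction.
  have hfib : ∀ c ∈ M₀ ∪ Set.Iio N, {i | (e i).poly ≠ 0 ∧ rep i = c}.Finite := by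
    intro c hc
    refine Set.WellFoundedOn.induction
      (P := fun c => {i | (e i).poly ≠ 0 ∧ rep i = c}.Finite)
      (hM.wellFoundedOn (r := R)) hc fun c _ ih => ?_
    have hB : (⋃ c' ∈ {c' ∈ M₀ ∪ Set.Iio N | R c' c},
        {i | (e i).poly ≠ 0 ∧ rep i = c'}).Finite :=
      (hM.subset fun _ h => h.1).biUnion fun c' hc' => ih c' hc'.1 hc'.2
    have hfin : ({i | (e i).poly ≠ 0 ∧ rep i = c} ∩ Set.Ici N).Finite := by
      refine Set.Finite.of_injOn (f := par) ?_ (hinj.mono Set.inter_subset_right) (hB.prod hB)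
      rintro i ⟨⟨hi0, rfl⟩, hi⟩
      have hr : ∀ j, (e j).poly ≠ 0 → T.RatioLt m (e j) (e i) → j ∈ ⋃ c' ∈
          {c' ∈ M₀ ∪ Set.Iio N | R c' (rep i)}, {i | (e i).poly ≠ 0 ∧ rep i = c'} :=
        fun j hj hji => Set.mem_biUnion
          ⟨(hrep j hj).1, hji.congr (hrep j hj).2 (hrep i hi0).2⟩ ⟨hj, rfl⟩
      exact ⟨hr _ (hpar i hi).1 (hlt i hi hi0).1, hr _ (hpar i hi).2 (hlt i hi hi0).2⟩
    refine (hfin.union (Set.finite_Iio N)).subset fun i hi => ?_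
    rcases le_or_gt N i with h | h
    · exact Or.inl ⟨hi, h⟩
    · exact Or.inr h
  have hA : {i | (e i).poly ≠ 0}.Finite :=
    (hM.biUnion hfib).subset fun i hi => Set.mem_biUnion (hrep i hi).1 ⟨hi, rfl⟩
  -- Elements with zero polynomial also come from distinct pairs of nonzero elements, so they cannot
  -- be infinitely many either.
  exact Set.Ici_infinite N (Set.Finite.of_injOn (f := par) (fun i hi => hpar i hi) hinj
    (hA.prod hA))

end ratio

namespace Tree

variable {T T' : Tree n K} {m : MonomialOrder (Fin n)} {α β γ δ : SigPoly n K} {ν : ℕ}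

/-- The component `a α` has signature `𝔰(γ)` and leading monomial the lcm, which is larger than that
of `γ`; so `γ` has a larger ratio than `α`. The component `b β` has the same leading monomial and a
smaller signature still. -/
theorem ratioLt_of_sig_eq
    (hlt : T.SigLt m (Signature.mul (cofactor m β.poly α.poly) β.sig)
      (Signature.mul (cofactor m α.poly β.poly) α.sig))
    (hs : γ.sig = Signature.mul (cofactor m α.poly β.poly) α.sig)
    (hd : m.degree γ.poly ≺[m] m.degree α.poly ⊔ m.degree β.poly) :
    T.RatioLt m α γ ∧ T.RatioLt m β γ := by
  have hα := cofactor_add_degree m α.poly β.poly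
  have hβ := cofactor_add_degree m β.poly α.poly
  rw [sup_comm] at hβ
  constructor
  · refine Or.inr ⟨by rw [hs]; rfl, ?_⟩
    rw [hs]
    simp only [Signature.mul]
    rw [add_right_comm, hα, add_comm, map_add, map_add]
    gcongr
  · rcases hlt with hlt | hlt
    · left
      rw [hs]
      exact hlt
    · refine Or.inr ⟨hlt.1.trans (by rw [hs]), ?_⟩
      have h := hlt.2
      rw [hs]
      simp only [Signature.mul] at h ⊢
      rw [map_add, map_add] at h
      refine lt_of_add_lt_add_left (a := m.toSyn (cofactor m β.poly α.poly)) ?_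
      calc _ = m.toSyn (cofactor m β.poly α.poly) + m.toSyn β.sig.mon +
            m.toSyn (m.degree γ.poly) := by rw [map_add, add_assoc]
        _ < m.toSyn (cofactor m α.poly β.poly) + m.toSyn α.sig.mon +
            m.toSyn (m.degree α.poly ⊔ m.degree β.poly) := add_lt_add h hd
        _ = _ := by
          rw [← hβ]
          simp only [map_add]
          abel

/-- The result of the reduction of an S-pair has a larger ratio than the members of the pair. -/
theorem MinPair.ratioLt (hT : T.Inv m) {p : ℕ × ℕ} (hp : T.MinPair m ν p α β)
    (hs : γ.sig = (T.sPair m α β).sig)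
    (hd : m.degree γ.poly ≺[m] m.degree α.poly ⊔ m.degree β.poly) :
    T.RatioLt m α γ ∧ T.RatioLt m β γ := by
  rcases (hp.regular hT).sPair_sig hT.wf with ⟨h₁, h₂⟩ | ⟨h₁, h₂⟩
  · exact ratioLt_of_sig_eq h₁ (hs.trans h₂) hd
  · rw [sup_comm] at hd
    exact (ratioLt_of_sig_eq h₁ (hs.trans h₂) hd).symm

theorem MinPair.sPair_ind_le (hT : T.Inv m) {p : ℕ × ℕ} (hp : T.MinPair m ν p α β) :
    T.Le (T.sPair m α β).sig.ind ν := by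
  rcases (hp.regular hT).sPair_sig hT.wf with ⟨_, h₂⟩ | ⟨_, h₂⟩
  · rw [h₂]
    exact hp.1.2.2.2.1
  · rw [h₂]
    exact hp.1.2.2.2.2

/-- The result of a regular reduction whose signature and leading monomial are divisible by those
of an element of the basis has the same ratio as this element. -/
theorem MinPair.ratioEq_of_le (hT : T.Inv m) {p : ℕ × ℕ} (hp : T.MinPair m ν p α β)
    (hγ : T.IsSig m γ) (hs : γ.sig = (T.sPair m α β).sig) (hirr : ∀ γ', ¬ T.ReduceStep m γ γ')
    (hγ0 : γ.poly ≠ 0) (hδ : δ ∈ T.G) (hδ0 : δ.poly ≠ 0) (hind : δ.sig.ind = γ.sig.ind)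
    (hmon : δ.sig.mon ≤ γ.sig.mon) (hdeg : m.degree δ.poly ≤ m.degree γ.poly) :
    RatioEq m δ γ := by
  refine ⟨hind, ?_⟩
  obtain ⟨t, ht⟩ := exists_add_of_le hmon
  obtain ⟨s, hs'⟩ := exists_add_of_le hdeg
  rcases lt_trichotomy (m.toSyn s) (m.toSyn t) with h | h | h
  -- In this case `s δ` has the leading monomial of `γ` and a smaller signature, so it would reduce
  -- `γ`.
  · refine absurd (Or.inr ⟨hind, ?_⟩) (not_sigLt_of_irreducible hirr hγ0 hδ hδ0 hdeg)
    simp only [Signature.mul]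
    rw [hs', add_tsub_cancel_left, ht, add_comm, map_add, map_add]
    gcongr
  · rw [ht, hs', m.toSyn.injective h]
    abel
  -- In this case `t δ` has the signature of `γ` and a smaller leading monomial. Subtracting a
  -- multiple of it from `γ` keeps the leading monomial and lowers the signature.
  · exfalso
    have hδ' := hT.isSig δ hδ
    obtain ⟨c, hc⟩ := exists_cancel m (q := γ.quo) (s := monomial t (1 : K) * δ.quo)
      (d := γ.sig.mon) (fun e he => hγ.degree_quo ▸ m.le_degree he)
      (monomial_mul_ne_zero one_ne_zero hδ'.quo_ne_zero) (by
        rw [degree_monomial_mul m one_ne_zero hδ'.quo_ne_zero, hδ'.degree_quo, ht, add_comm])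
    have hlt : m.degree (C c * (monomial t (1 : K) * δ.poly)) ≺[m] m.degree γ.poly := by
      rw [← smul_eq_C_mul]
      refine lt_of_le_of_lt m.degree_smul_le ?_
      rw [degree_monomial_mul m one_ne_zero hδ0, hs', add_comm, map_add, map_add]
      gcongr
    have hp'deg := m.degree_sub_of_lt hlt
    have hp'0 : γ.poly - C c * (monomial t (1 : K) * δ.poly) ≠ 0 := by
      intro h0
      rw [sub_eq_zero] at h0
      rw [← h0] at hlt
      exact lt_irrefl _ hlt
    have hmem : (γ.poly - C c * (monomial t 1 * δ.poly)) -
        (γ.quo - C c * (monomial t 1 * δ.quo)) * T.val γ.sig.ind ∈ T.below γ.sig.ind := by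
      have h := hδ'.sub_mem
      rw [hind] at h
      have := Ideal.sub_mem _ hγ.sub_mem (Ideal.mul_mem_left _ (C c * monomial t 1) h)
      convert this using 1
      ring
    obtain ⟨τ, hτ, hτp⟩ := exists_spans_lt hT.wf hp'0 hc hmem
    have hτν : T.Le τ.ind ν := by
      refine hτ.ind_le.trans ?_
      rw [hs]
      exact hp.sPair_ind_le hT
    -- By minimality of the chosen pair, no remaining pair has signature at most `τ`. Hence there is
    -- a reducer of the leading monomial with signature below that of `γ`, against irreducibility.
    obtain ⟨j, ε, hj, hε0, hle, hεlt, _⟩ := exists_reducer hT.wf hT.isSig hT.unit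
      (hτ.ind_le.mem hT.wf hγ.mem) (hT.rewritablePairs hτν fun p' α' β' h' h'' => by
        apply hp.2 p' α' β' h'
        rw [← hs]
        rcases h'' with h'' | h''
        · exact h''.trans hT.wf hτ
        · rwa [h'']) hp'0 hτp
    rw [hp'deg] at hle hεlt
    refine not_sigLt_of_irreducible hirr hγ0 (List.mem_of_getElem? hj) hε0 hle ?_
    rcases hεlt with h' | h'
    · exact h'.trans hT.wf hτ
    · rwa [h']

theorem Inv.finite_P (hT : T.Inv m) : T.P.Finite := by
  refine ((Set.finite_Iio T.G.length).prod (Set.finite_Iio T.G.length)).subset fun p hp => ?_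
  have := hT.pair_lt p hp
  exact ⟨this.2, this.1.trans this.2⟩

theorem Round.length_eq (h : T.Round m ν T') :
    (T'.G.length = T.G.length ∧ ∃ p ∈ T.P, T'.P = T.P \ {p}) ∨
      T'.G.length = T.G.length + 1 := by
  obtain ⟨p, α, β, hp, ⟨_, rfl⟩ | ⟨γ, _, _, _, _, rfl⟩⟩ := h
  · exact Or.inl ⟨rfl, p, hp.1.1, rfl⟩
  · right
    rw [addReduced_G, List.length_append, List.length_singleton]

theorem Round.mem_P (h : T.Round m ν T') {p : ℕ × ℕ} (hp : p ∈ T'.P) :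
    p ∈ T.P ∨ p.1 = T.G.length := by
  obtain ⟨q, α, β, _, ⟨_, rfl⟩ | ⟨γ, _, _, _, _, rfl⟩⟩ := h
  · exact Or.inl hp.1
  · rcases mem_addReduced_P.1 hp with h' | h'
    · exact Or.inl h'.1
    · exact Or.inr h'.1

theorem RatioLt.of_parent (h : T'.parent = T.parent) :
    T'.RatioLt m α β ↔ T.RatioLt m α β := by
  simp only [RatioLt, Lt, Le.eq_of_parent h]

/-- A sequence of iterations of the main loop adds arbitrarily many elements to the basis. -/
theorem exists_lt_length {Ts : ℕ → Tree n K} (hinv : ∀ k, (Ts k).Inv m)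
    (hstep : ∀ k, (Ts k).Round m ν (Ts (k + 1))) (N : ℕ) : ∃ k, N < (Ts k).G.length := by
  by_contra hcon
  push Not at hcon
  have hwf : WellFounded (Prod.Lex (· < ·) (· < ·) : ℕ × ℕ → ℕ × ℕ → Prop) :=
    WellFounded.prod_lex wellFounded_lt wellFounded_lt
  -- If the length stayed at most `N`, an insertion would lower the first component and a discarded
  -- pair the second.
  refine (wellFounded_iff_isEmpty_descending_chain.1 hwf).false
    ⟨fun k => (N - (Ts k).G.length, (Ts k).P.ncard), fun k => ?_⟩
  rcases (hstep k).length_eq with ⟨h, p, hp, hP⟩ | h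
  · simp only [h]
    refine Prod.Lex.right _ ?_
    rw [hP]
    exact Set.ncard_sdiff_singleton_lt_of_mem hp (hinv k).finite_P
  · refine Prod.Lex.left _ _ ?_
    have := hcon (k + 1)
    omega

/-- The main loop terminates. -/
theorem Inv.acc_round (hT : T.Inv m) : Acc (fun T' T => T.Round m ν T') T := by
  by_contra hacc
  obtain ⟨Ts, rfl, hstep⟩ := not_acc_iff_exists_descending_chain.1 hacc
  have hinv : ∀ k, (Ts k).Inv m := fun k => by
    induction k with
    | zero => exact hT
    | succ k ih => exact (hstep k).inv ih
  have hnodes : ∀ k, (Ts k).nodes = (Ts 0).nodes := fun k => by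
    induction k with
    | zero => rfl
    | succ k ih => exact (hstep k).nodes_eq.trans ih
  have hparent : ∀ k, (Ts k).parent = (Ts 0).parent := fun k => by
    induction k with
    | zero => rfl
    | succ k ih => exact (hstep k).parent_eq.trans ih
  have hprefix : ∀ {k l}, k ≤ l → (Ts k).G <+: (Ts l).G := fun {k l} h => by
    induction h with
    | refl => exact List.prefix_refl _
    | step _ ih => exact ih.trans (hstep _).G_prefix
  choose s hs using exists_lt_length hinv hstep
  -- The basis only grows by appending, so its entry at position `i` is the same in every state that
  -- has one.
  let e : ℕ → SigPoly n K := fun i => (Ts (s i)).G[i]'(hs i)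
  have he : ∀ k i, i < (Ts k).G.length → (Ts k).G[i]? = some (e i) := by
    intro k i hi
    have h : (Ts (s i)).G[i]? = some (e i) := List.getElem?_eq_getElem (hs i)
    rcases le_total k (s i) with hk | hk
    · obtain ⟨l, hl⟩ := hprefix hk
      rwa [← hl, List.getElem?_append_left hi] at h
    · obtain ⟨l, hl⟩ := hprefix hk
      rwa [← hl, List.getElem?_append_left (hs i)]
  have htime : ∀ i, (Ts 0).G.length ≤ i →
      ∃ t, (Ts t).G.length = i ∧ (Ts (t + 1)).G.length = i + 1 := by
    intro i hi
    classical
    have hex : ∃ k, i < (Ts k).G.length := ⟨s i, hs i⟩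
    obtain ⟨t, ht⟩ : ∃ t, Nat.find hex = t + 1 := by
      refine Nat.exists_eq_succ_of_ne_zero fun h0 => ?_
      have := Nat.find_spec hex
      rw [h0] at this
      omega
    have h₁ : i < (Ts (t + 1)).G.length := ht ▸ Nat.find_spec hex
    have h₂ : ¬ i < (Ts t).G.length := Nat.find_min hex (by omega)
    have h₃ := (hstep t).length_eq
    exact ⟨t, by omega, by omega⟩
  -- For each entry that is not in the initial basis: the round that inserts it, and the pair of
  -- positions from which it arises.
  have hdata : ∀ i, ∃ p : ℕ × ℕ, (Ts 0).G.length ≤ i →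
      ∃ t, (Ts t).G.length = i ∧ (Ts (t + 1)).G.length = i + 1 ∧ p ∉ (Ts (t + 1)).P ∧
        (Ts t).MinPair m ν p (e p.1) (e p.2) ∧ p.1 < i ∧
        (Ts t).IsSig m (e i) ∧ (e i).sig = ((Ts t).sPair m (e p.1) (e p.2)).sig ∧
        ((e i).poly ≠ 0 → m.degree (e i).poly ≺[m]
          m.degree (e p.1).poly ⊔ m.degree (e p.2).poly) ∧
        ∀ γ', ¬ (Ts t).ReduceStep m (e i) γ' := by
    intro i
    by_cases hi : (Ts 0).G.length ≤ i
    · obtain ⟨t, ht, ht'⟩ := htime i hi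
      obtain ⟨p, α, β, hp, ⟨_, h⟩ | ⟨γ, h₁, h₂, h₃, h₄, h⟩⟩ := hstep t
      · rw [h] at ht'
        have : (Ts t).G.length = i + 1 := ht'
        omega
      · have hplt := (hinv t).pair_lt p hp.1.1
        have e₁ := Option.some.inj ((he t p.1 hplt.2).symm.trans hp.1.2.1)
        have e₂ := Option.some.inj
          ((he t p.2 (hplt.1.trans hplt.2)).symm.trans hp.1.2.2.1)
        have e₃ : e i = γ := by
          have := he (t + 1) i (by omega)
          rw [h, addReduced_G] at this
          simpa [ht] using this.symm
        refine ⟨p, fun _ => ⟨t, ht, ht', ?_, ?_⟩⟩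
        · rw [h, mem_addReduced_P]
          rintro (h' | h')
          · exact h'.2 rfl
          · exact absurd h'.1 (ne_of_lt hplt.2)
        · rw [e₁, e₂, e₃]
          exact ⟨hp, ht ▸ hplt.2, h₁, h₂, h₃, h₄⟩
    · exact ⟨(0, 0), fun h => absurd h hi⟩
  choose par hpar using hdata
  -- A removed pair never returns, because new pairs have the position of the new entry as first
  -- member. Hence distinct entries arise from distinct pairs.
  have hgone : ∀ (p : ℕ × ℕ) (k l : ℕ), k ≤ l → p ∉ (Ts k).P → p.1 < (Ts k).G.length →
      p ∉ (Ts l).P := by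
    intro p k l hkl hp hlt
    induction hkl with
    | refl => exact hp
    | @step l hkl ih =>
      intro h
      rcases (hstep l).mem_P h with h' | h'
      · exact ih h'
      · have := (hprefix hkl).length_le
        omega
  have hne : ∀ i j, (Ts 0).G.length ≤ i → i < j → par i ≠ par j := by
    intro i j hi hij heq
    obtain ⟨t, ht, ht', hp, _, hlt, _⟩ := hpar i hi
    obtain ⟨u, hu, _, _, hmin, _⟩ := hpar j (hi.trans hij.le)
    have htu : t + 1 ≤ u := by
      by_contra hcon
      have := (hprefix (show u ≤ t by omega)).length_le
      omega
    exact hgone _ _ _ htu hp (by omega) (heq ▸ hmin.1.1)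
  refine not_infinite_sequence (m := m) hT.wf e (Ts 0).G.length par ?_ ?_ ?_ ?_ ?_
  · intro i
    rw [← hnodes (s i)]
    exact ((hinv (s i)).isSig _ (List.getElem_mem (hs i))).mem
  · intro i hi j hj heq
    rcases lt_trichotomy i j with h | h | h
    · exact absurd heq (hne i j hi h)
    · exact h
    · exact absurd heq.symm (hne j i hj h)
  · intro i hi
    obtain ⟨t, _, _, _, hmin, _⟩ := hpar i hi
    have := hmin.regular (hinv t)
    exact ⟨this.1, this.2.1⟩
  · intro i hi h0
    obtain ⟨t, _, _, _, hmin, _, _, hsig, hdeg, _⟩ := hpar i hi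
    -- Rounds do not change the tree, so ratios may be compared in any of the states.
    rw [← RatioLt.of_parent (hparent t), ← RatioLt.of_parent (hparent t)]
    exact hmin.ratioLt (hinv t) hsig (hdeg h0)
  · intro i j hi hji hi0 hj0 hind hmon hdeg
    obtain ⟨t, ht, _, _, hmin, _, hisSig, hsig, _, hirr⟩ := hpar i hi
    exact hmin.ratioEq_of_le (hinv t) hisSig hsig hirr hi0
      (List.mem_of_getElem? (he t j (by omega))) hj0 hind hmon hdeg

end Tree

end SigGB

theorem mainTheorem5 {n : ℕ} {K : Type*} [Field K] (m : MonomialOrder (Fin n))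
    (T : SigGB.Tree n K) (hT : T.Reachable m) (ν : ℕ) (hν : ν ∈ T.nodes) :
    (¬ ∃ run : ℕ → SigGB.Config n K (Set (MvPolynomial (Fin n) K)),
      run 0 = .loop T ∧ ∀ k, SigGB.BasisStep m ν (run k) (run (k + 1))) ∧
    (∀ c : SigGB.Config n K (Set (MvPolynomial (Fin n) K)),
      Relation.ReflTransGen (SigGB.BasisStep m ν) (.loop T) c →
      (∀ c', ¬ SigGB.BasisStep m ν c c') →
      ∃ (T' : SigGB.Tree n K) (out : Set (MvPolynomial (Fin n) K)),
        c = .returned T' out ∧ SigGB.IsGroebnerBasis m out (T.pathIdeal ν)) := by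
  have hinv := hT.inv
  refine ⟨?_, fun c h hc => SigGB.isGroebnerBasis_of_terminal hinv hν h hc⟩
  rintro ⟨run, h0, hrun⟩
  exact not_acc_iff_exists_descending_chain.2 ⟨run, h0, hrun⟩
    (SigGB.acc_loop hinv hinv.acc_round)
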